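/- Let $\Bbbk$ be a field, $n\ge 0$, and let $S=\Bbbk[x_1,\dots,x_n]$ be the standard graded polynomial ring, with maximal homogeneous ideal $(x_1,\dots,x_n)$, so that $\Bbbk=S/(x_1,\dots,x_n)$. Let the symmetric group $\mathfrak{S}_n$ act on $S$ by permuting the variables. For $\mathbf a=(a_1,\dots,a_n)\in\mathbb{Z}_{\ge 0}^n$ write $x^{\mathbf a}=x_1^{a_1}\cdots x_n^{a_n}$. A monomial ideal $I\subset S$ is called a *symmetric shifted ideal* if $\sigma(I)=I$ for all $\sigma\in\mathfrak{S}_n$ and if, for every $\lambda=(\lambda_1\le\cdots\le\lambda_n)$ in $\mathbb{Z}_{\ge0}^n$ with $x^\lambda\in I$ and every $1\le k<n$ with $\lambda_k<\lambda_n$, one has $x^\lambda(x_k/x_n)\in I$. Let $G(I)$ be the set of minimal monomial generators of $I$. For a monomial $u=\sigma(x^\lambda)=x_{\sigma(1)}^{\lambda_1}\cdots x_{\sigma(n)}^{\lambda_n}$, with $\sigma\in\mathfrak{S}_n$ and $\lambda_1\le\cdots\le\lambda_n$, put $$p=\#\{k:\lambda_k<\lambda_n-1\},\qquad r=\#\{k:\lambda_k=\lambda_n\},\qquad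 \max(u)=\max\{\sigma(k):\lambda_k=\lambda_n\},$$ $$C(u)=\{x_{\sigma(1)},\dots,x_{\sigma(p)}\}\cup\{x_{\sigma(k)}: p+1\le k\le n-r,\ \sigma(k)<\max(u)\}$$ (this set depends only on $u$; it is empty if $n=0$). Let $\beta_{i,e}(I)=\dim_{\Bbbk}\operatorname{Tor}^S_i(I,\Bbbk)_e$ be the graded Betti numbers of $I$, where $\operatorname{Tor}^S_i(I,\Bbbk)_e$ is the degree-$e$ component of the $i$-th homology of $F_\bullet\otimes_S\Bbbk$ for any graded free resolution $F_\bullet$ of $I$. If $I$ is a symmetric shifted ideal, then for all integers $i\ge 0$ and all integers $j$, $$\beta_{i,i+j}(I)=\sum_{u\in G(I),\ \deg u=j}\binom{|C(u)|}{i}.$$ -/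

import Mathlib

universe u

open scoped TensorProduct

namespace SymmetricShifted

/-! ### Monomial ideals and symmetric shifted ideals

Monomials of `S = k[x_1, …, x_n]` are identified with exponent vectors `a : Fin n →₀ ℕ`. -/

/-- `I` is generated by monomials. -/
def IsMonomialIdeal {k : Type u} [Field k] {n : ℕ} (I : Ideal (MvPolynomial (Fin n) k)) : Prop :=
  ∃ A : Set (Fin n →₀ ℕ), I = Ideal.span ((fun a => MvPolynomial.monomial a (1 : k)) '' A)

/-- `σ(I) = I` for every permutation `σ` of the variables. -/
def IsSymmFixed {k : Type u} [Field k] {n : ℕ} (I : Ideal (MvPolynomial (Fin n) k)) : Prop :=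
  ∀ σ : Equiv.Perm (Fin n), I.map (MvPolynomial.rename (R := k) σ) = I

/-- Symmetric shifted ideals: `𝔖_n`-fixed monomial ideals such that for every non-decreasing
`lam = (lam_1 ≤ ⋯ ≤ lam_n)` with `x^lam ∈ I` and every `i < n` with `lam_i < lam_n`, the monomial
`x^lam (x_i / x_n)` lies in `I`. Below, `l` is the last index `n` (there is none if there are
no variables). -/
structure IsSymmetricShifted {k : Type u} [Field k] {n : ℕ}
    (I : Ideal (MvPolynomial (Fin n) k)) : Prop where
  monomial : IsMonomialIdeal I
  symm_fixed : IsSymmFixed I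
  shift : ∀ lam : Fin n →₀ ℕ, Monotone lam → MvPolynomial.monomial lam (1 : k) ∈ I →
    ∀ i l : Fin n, (l : ℕ) + 1 = n → i < l → lam i < lam l →
      MvPolynomial.monomial (lam - Finsupp.single l 1 + Finsupp.single i 1) (1 : k) ∈ I

/-- The exponent vectors of the monomials of `I` that are minimal under divisibility. -/
def minMonomials {k : Type u} [Field k] {n : ℕ} (I : Ideal (MvPolynomial (Fin n) k)) :
    Set (Fin n →₀ ℕ) :=
  {a | Minimal (fun b => MvPolynomial.monomial b (1 : k) ∈ I) a}

theorem minMonomials_finite {k : Type u} [Field k] {n : ℕ}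
    (I : Ideal (MvPolynomial (Fin n) k)) : (minMonomials I).Finite :=
  WellQuasiOrderedLE.finite_of_isAntichain
    (setOfPred_minimal_antichain (fun b => MvPolynomial.monomial b (1 : k) ∈ I))

/-- `G(I)`: the (finite) set of minimal monomial generators of a monomial ideal `I`. -/
noncomputable def minGens {k : Type u} [Field k] {n : ℕ} (I : Ideal (MvPolynomial (Fin n) k)) :
    Finset (Fin n →₀ ℕ) :=
  (minMonomials_finite I).toFinset

/-- The largest exponent of the monomial `x^a`, i.e. the last part of `part(x^a)`. -/
def maxExp {n : ℕ} (a : Fin n →₀ ℕ) : ℕ := Finset.univ.sup a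

/-- `C(u)` for `u = x^a`, as a set of indices of variables. Write `u = σ(x^lam)` with `lam`
non-decreasing; then `lam_k` is the exponent of `x_{σ(k)}` in `u`, and `M = lam_n` is the largest
exponent of `u`. The variables `x_{σ(k)}` with `k ≤ p(lam)` are those of exponent `< M - 1`; the
variables `x_{σ(k)}` with `p(lam) < k ≤ n - r(lam)` are those of exponent `M - 1`; and `max(u)` is
the largest index `l` of a variable of exponent `M`, so that `i < max(u)` means that `i < l` for
some such `l`. -/
def varsC {n : ℕ} (a : Fin n →₀ ℕ) : Finset (Fin n) :=
  Finset.univ.filter (fun i => a i + 1 < maxExp a) ∪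
    Finset.univ.filter (fun i => a i + 1 = maxExp a ∧ ∃ l, a l = maxExp a ∧ i < l)

/-! ### Graded free resolutions and graded Betti numbers

The homological notions are written for a commutative algebra `S` over the field `k`, with a family
`𝒮 e` (`e : ℤ`) of homogeneous components and an ideal `𝔪`. They are used only for
`S = k[x_1, …, x_n]` with its standard grading and `𝔪 = (x_1, …, x_n)`. -/

section Resolutions

variable {k S : Type u} [Field k] [CommRing S] [Algebra k S]

/-- The degree `e` component of the graded free module `⨁_{b ∈ B} S(-deg b)`, whose basis vector
indexed by `b` has degree `deg b`. -/
def freePiece (𝒮 : ℤ → Submodule k S) {B : Type u} (deg : B → ℤ) (e : ℤ) :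
    Submodule k (B →₀ S) where
  carrier := {x | ∀ b, x b ∈ 𝒮 (e - deg b)}
  zero_mem' := fun _ => Submodule.zero_mem _
  add_mem' := fun hx hy b => Submodule.add_mem _ (hx b) (hy b)
  smul_mem' := fun c _ hx b => Submodule.smul_mem _ c (hx b)

/-- A graded free resolution `⋯ → F_2 → F_1 → F_0 → I → 0` of the `S`-module `I`, with
`F_i = ⨁_{b ∈ B i} S(-deg i b)` and homogeneous maps of degree zero. Neither minimality nor
finiteness is required. -/
structure GradedFreeResolution (𝒮 : ℤ → Submodule k S) (I : Ideal S) where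
  B : ℕ → Type u
  deg : ∀ i, B i → ℤ
  d : ∀ i, (B (i + 1) →₀ S) →ₗ[S] (B i →₀ S)
  aug : (B 0 →₀ S) →ₗ[S] I
  d_homogeneous : ∀ i b, d i (Finsupp.single b 1) ∈ freePiece 𝒮 (deg i) (deg (i + 1) b)
  aug_homogeneous : ∀ b, (aug (Finsupp.single b 1) : S) ∈ 𝒮 (deg 0 b)
  aug_surjective : Function.Surjective aug
  exact_zero : Function.Exact (d 0) aug
  exact_succ : ∀ i, Function.Exact (d (i + 1)) (d i)

namespace GradedFreeResolution

variable {𝒮 : ℤ → Submodule k S} {I : Ideal S}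

/-- The module `(S/𝔪) ⊗_S F_i`. -/
abbrev TensorTerm (F : GradedFreeResolution 𝒮 I) (𝔪 : Ideal S) (i : ℕ) : Type u :=
  (S ⧸ 𝔪) ⊗[S] (F.B i →₀ S)

/-- The differential `(S/𝔪) ⊗_S F_{i+1} → (S/𝔪) ⊗_S F_i`, as a `k`-linear map. -/
noncomputable def tensorD (F : GradedFreeResolution 𝒮 I) (𝔪 : Ideal S) (i : ℕ) :
    F.TensorTerm 𝔪 (i + 1) →ₗ[k] F.TensorTerm 𝔪 i :=
  ((F.d i).lTensor (S ⧸ 𝔪)).restrictScalars k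

/-- The degree `e` component of `(S/𝔪) ⊗_S F_i`, where `S/𝔪 = k` sits in degree zero: all `1 ⊗ x`
with `x ∈ F_i` homogeneous of degree `e`. -/
noncomputable def tensorPiece (F : GradedFreeResolution 𝒮 I) (𝔪 : Ideal S) (i : ℕ) (e : ℤ) :
    Submodule k (F.TensorTerm 𝔪 i) :=
  (freePiece 𝒮 (F.deg i) e).map
    ((TensorProduct.mk S (S ⧸ 𝔪) (F.B i →₀ S) 1).restrictScalars k)

/-- Cycles of degree `e` of the complex `(S/𝔪) ⊗_S F` in homological degree `i`. -/
noncomputable def cycles (F : GradedFreeResolution 𝒮 I) (𝔪 : Ideal S) :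
    ∀ (i : ℕ) (_ : ℤ), Submodule k (F.TensorTerm 𝔪 i)
  | 0, e => F.tensorPiece 𝔪 0 e
  | i + 1, e => F.tensorPiece 𝔪 (i + 1) e ⊓ LinearMap.ker (F.tensorD 𝔪 i)

/-- Boundaries of degree `e` of the complex `(S/𝔪) ⊗_S F` in homological degree `i`. -/
noncomputable def boundaries (F : GradedFreeResolution 𝒮 I) (𝔪 : Ideal S) (i : ℕ) (e : ℤ) :
    Submodule k (F.TensorTerm 𝔪 i) :=
  (F.tensorPiece 𝔪 (i + 1) e).map (F.tensorD 𝔪 i)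

/-- `Tor_i(I, S/𝔪)_e`, computed from the graded free resolution `F` of `I`: the degree `e` component
of the `i`-th homology of `(S/𝔪) ⊗_S F`, i.e. cycles modulo boundaries. The quotient is realized as
the space of classes of cycles inside the quotient of `(S/𝔪) ⊗_S F_i` by the boundaries. -/
noncomputable def Tor (F : GradedFreeResolution 𝒮 I) (𝔪 : Ideal S) (i : ℕ) (e : ℤ) :
    Submodule k (F.TensorTerm 𝔪 i ⧸ F.boundaries 𝔪 i e) :=
  (F.cycles 𝔪 i e).map (F.boundaries 𝔪 i e).mkQ

end GradedFreeResolution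

end Resolutions

/-- The degree `e` component of the standard graded polynomial ring `k[x_1, …, x_n]`, for `e : ℤ`
(it is zero for `e < 0`). -/
def polyPiece (k : Type u) [Field k] (n : ℕ) (e : ℤ) : Submodule k (MvPolynomial (Fin n) k) where
  carrier := {f | ∀ m : Fin n →₀ ℕ, f.coeff m ≠ 0 → (m.degree : ℤ) = e}
  zero_mem' := fun m hm => absurd (MvPolynomial.coeff_zero m) hm
  add_mem' := fun {f g} hf hg m hm => by
    by_cases h : f.coeff m = 0
    · exact hg m fun h' => hm (by rw [MvPolynomial.coeff_add, h, h', add_zero])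
    · exact hf m h
  smul_mem' := fun c f hf m hm => hf m fun h => hm (by rw [MvPolynomial.coeff_smul, h, smul_zero])

/-- `β_{i,e}(I) = dim_k Tor_i(I, k)_e` is the natural number `N`, where `k = S/(x_1, …, x_n)`: graded
free resolutions of `I` exist, and `Tor_i(I, k)_e` has dimension `N` whichever of them it is
computed from. -/
def HasGradedBetti {k : Type u} [Field k] {n : ℕ} (I : Ideal (MvPolynomial (Fin n) k))
    (i : ℕ) (e : ℤ) (N : ℕ) : Prop :=
  Nonempty (GradedFreeResolution (polyPiece k n) I) ∧
    ∀ F : GradedFreeResolution (polyPiece k n) I,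
      Module.rank k (F.Tor (MvPolynomial.idealOfVars (Fin n) k) i e) = (N : Cardinal.{u})

end SymmetricShifted

/-! A symmetric shifted ideal has linear quotients. Order `G(I)` by degree, then by largest exponent
`maxExp`, then by the last position `topIndex` of that exponent (`orderKey`). If `s` consists of
generators with key at most that of `u`, contains all those with smaller key and omits `u`, then the
colon ideal `(s) : x^u` is generated by the variables in `C(u)`.

One inclusion holds because trading the last maximal variable of `u` for some `x_i` in `C(u)` stays
in `I` and lowers the key (`exists_smaller_generator`). For the other, an earlier generator `v` must
exceed `u` at some index of `C(u)`: otherwise exchanges turn `v` into a proper divisor of `u`, or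
the order is violated (`exists_mem_varsC`).

Adding generators in this order, each step is the mapping cone of a comparison map from a shifted
Koszul complex on `C(u)` (`Resolves.exists_coneData`, `exists_koszul`). Since degrees never decrease
along the order, the entries of these maps have positive degree and the cone stays minimal. Each `u`
thus contributes `binom(|C(u)|, i)` basis vectors of degree `deg u + i`. For a minimal resolution
the Betti numbers count basis vectors (`rank_Tor_of_minimal`), and `rank_Tor_le`, applied in both
directions, transfers the count to every graded free resolution. -/

namespace SymmetricShifted

variable {k : Type u} [Field k] {n : ℕ}

/-! ### Homogeneous maps of graded free modules -/

theorem mul_mem_polyPiece {a b : ℤ} {f g : MvPolynomial (Fin n) k} (hf : f ∈ polyPiece k n a)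
    (hg : g ∈ polyPiece k n b) : f * g ∈ polyPiece k n (a + b) := by
  classical
  intro m hm
  rw [MvPolynomial.coeff_mul] at hm
  obtain ⟨⟨p, q⟩, hpq, h⟩ := Finset.exists_ne_zero_of_sum_ne_zero hm
  rw [Finset.HasAntidiagonal.mem_antidiagonal] at hpq
  have h1 := hf p (left_ne_zero_of_mul h)
  have h2 := hg q (right_ne_zero_of_mul h)
  simp only at hpq
  rw [← hpq, map_add, Nat.cast_add, h1, h2]

theorem monomial_mem_polyPiece (a : Fin n →₀ ℕ) (c : k) :
    MvPolynomial.monomial a c ∈ polyPiece k n a.degree := by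
  classical
  intro m hm
  rw [MvPolynomial.coeff_monomial] at hm
  split_ifs at hm with h
  · rw [h]
  · exact absurd rfl hm

theorem one_mem_polyPiece : (1 : MvPolynomial (Fin n) k) ∈ polyPiece k n 0 := by
  simpa using monomial_mem_polyPiece (k := k) (0 : Fin n →₀ ℕ) 1

theorem coeff_zero_of_mem_polyPiece {e : ℤ} (he : e ≠ 0) {f : MvPolynomial (Fin n) k}
    (hf : f ∈ polyPiece k n e) : f.coeff 0 = 0 := by
  by_contra h
  exact he (by simpa using (hf 0 h).symm)

variable (k n) in
/-- The projection of the polynomial ring onto its component of degree `e`. -/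
noncomputable def polyProj (e : ℤ) : MvPolynomial (Fin n) k →ₗ[k] MvPolynomial (Fin n) k :=
  -- For `e < 0`, `e.toNat = 0` would select the constants, whereas `polyPiece k n e` is zero.
  if 0 ≤ e then MvPolynomial.homogeneousComponent e.toNat else 0

theorem coeff_polyProj (e : ℤ) (f : MvPolynomial (Fin n) k) (m : Fin n →₀ ℕ) :
    (polyProj k n e f).coeff m = if (m.degree : ℤ) = e then f.coeff m else 0 := by
  unfold polyProj
  split_ifs with h1 h2 h2
  · rw [MvPolynomial.coeff_homogeneousComponent, if_pos (by omega)]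
  · rw [MvPolynomial.coeff_homogeneousComponent, if_neg (by omega)]
  · omega
  · simp

theorem polyProj_mem (e : ℤ) (f : MvPolynomial (Fin n) k) : polyProj k n e f ∈ polyPiece k n e := by
  intro m hm
  rw [coeff_polyProj] at hm
  by_contra h
  exact hm (if_neg h)

theorem polyProj_of_mem {e : ℤ} {f : MvPolynomial (Fin n) k} (hf : f ∈ polyPiece k n e) :
    polyProj k n e f = f := by
  ext m
  rw [coeff_polyProj]
  split_ifs with h
  · rfl
  · by_contra h'
    exact h (hf m (Ne.symm h'))

theorem polyProj_mul {a e : ℤ} (f : MvPolynomial (Fin n) k) {g : MvPolynomial (Fin n) k}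
    (hg : g ∈ polyPiece k n a) : polyProj k n e (f * g) = polyProj k n (e - a) f * g := by
  classical
  ext m
  have hite (s : k) : (if (m.degree : ℤ) = e then s else 0) =
      (if (m.degree : ℤ) = e then 1 else 0) * s := by split_ifs <;> simp
  rw [coeff_polyProj, MvPolynomial.coeff_mul, MvPolynomial.coeff_mul, hite, Finset.mul_sum]
  refine Finset.sum_congr rfl ?_
  rintro ⟨p, q⟩ hpq
  rw [Finset.HasAntidiagonal.mem_antidiagonal] at hpq
  simp only at hpq
  simp only [coeff_polyProj]
  by_cases hq : g.coeff q = 0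
  · simp [hq]
  have h2 := hg q hq
  have : (m.degree : ℤ) = p.degree + q.degree := by rw [← hpq, map_add, Nat.cast_add]
  by_cases h : (m.degree : ℤ) = e
  · rw [if_pos h, if_pos (by omega), one_mul]
  · rw [if_neg h, if_neg (by omega), zero_mul, zero_mul]

/-- A map of graded free modules that is homogeneous of degree zero. -/
def IsHomog {A B : Type u} (dA : A → ℤ) (dB : B → ℤ)
    (f : (A →₀ MvPolynomial (Fin n) k) →ₗ[MvPolynomial (Fin n) k] (B →₀ MvPolynomial (Fin n) k)) :
    Prop :=
  ∀ a, f (Finsupp.single a 1) ∈ freePiece (polyPiece k n) dB (dA a)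

section Homog

variable {A B C : Type u} {dA : A → ℤ} {dB : B → ℤ} {dC : C → ℤ}

theorem single_mem_freePiece (dA : A → ℤ) (a : A) :
    Finsupp.single a (1 : MvPolynomial (Fin n) k) ∈ freePiece (polyPiece k n) dA (dA a) := by
  classical
  intro b
  rw [Finsupp.single_apply]
  split_ifs with h
  · rw [h, sub_self]; exact one_mem_polyPiece
  · exact Submodule.zero_mem _

theorem map_eq_sum
    (f : (A →₀ MvPolynomial (Fin n) k) →ₗ[MvPolynomial (Fin n) k] (B →₀ MvPolynomial (Fin n) k))
    (x : A →₀ MvPolynomial (Fin n) k) (b : B) :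
    f x b = ∑ a ∈ x.support, x a * f (Finsupp.single a 1) b := by
  conv_lhs => rw [← Finsupp.sum_single x, Finsupp.sum, map_sum, Finsupp.finsetSum_apply]
  refine Finset.sum_congr rfl fun a _ => ?_
  rw [← Finsupp.smul_single_one, map_smul, Finsupp.smul_apply, smul_eq_mul]

variable {f : (A →₀ MvPolynomial (Fin n) k) →ₗ[MvPolynomial (Fin n) k]
  (B →₀ MvPolynomial (Fin n) k)}

theorem IsHomog.map_mem (hf : IsHomog dA dB f) {e : ℤ} {x : A →₀ MvPolynomial (Fin n) k}
    (hx : x ∈ freePiece (polyPiece k n) dA e) : f x ∈ freePiece (polyPiece k n) dB e := by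
  intro b
  rw [map_eq_sum]
  refine Submodule.sum_mem _ fun a _ => ?_
  have := mul_mem_polyPiece (hx a) (hf a b)
  rwa [sub_add_sub_cancel] at this

theorem IsHomog.comp {g : (B →₀ MvPolynomial (Fin n) k) →ₗ[MvPolynomial (Fin n) k]
    (C →₀ MvPolynomial (Fin n) k)} (hg : IsHomog dB dC g) (hf : IsHomog dA dB f) :
    IsHomog dA dC (g ∘ₗ f) :=
  fun a => hg.map_mem (hf a)

theorem IsHomog.sub {g : (A →₀ MvPolynomial (Fin n) k) →ₗ[MvPolynomial (Fin n) k]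
    (B →₀ MvPolynomial (Fin n) k)} (hf : IsHomog dA dB f) (hg : IsHomog dA dB g) :
    IsHomog dA dB (f - g) :=
  fun a => Submodule.sub_mem _ (hf a) (hg a)

theorem IsHomog.zero : IsHomog dA dB (0 : (A →₀ MvPolynomial (Fin n) k)
    →ₗ[MvPolynomial (Fin n) k] (B →₀ MvPolynomial (Fin n) k)) :=
  fun _ => Submodule.zero_mem _

theorem IsHomog.id : IsHomog dA dA (LinearMap.id : (A →₀ MvPolynomial (Fin n) k)
    →ₗ[MvPolynomial (Fin n) k] (A →₀ MvPolynomial (Fin n) k)) :=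
  fun a => single_mem_freePiece dA a

/-- The matrix entries of `f` are homogeneous, so truncating each coordinate `x a` of an arbitrary
preimage to degree `e - dA a` truncates `f x` to degree `e`, which leaves `y` unchanged. -/
theorem IsHomog.exists_preimage (hf : IsHomog dA dB f) {e : ℤ} {y : B →₀ MvPolynomial (Fin n) k}
    (hy : y ∈ freePiece (polyPiece k n) dB e) (h : y ∈ LinearMap.range f) :
    ∃ x ∈ freePiece (polyPiece k n) dA e, f x = y := by
  classical
  obtain ⟨x, rfl⟩ := h
  refine ⟨Finsupp.onFinset x.support (fun a => polyProj k n (e - dA a) (x a)) ?_, ?_, ?_⟩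
  · intro a ha
    rw [Finsupp.mem_support_iff]
    intro h
    exact ha (by rw [h, map_zero])
  · intro a
    exact polyProj_mem _ _
  · ext1 b
    rw [← polyProj_of_mem (hy b), map_eq_sum, map_eq_sum, map_sum]
    have hsub := Finsupp.support_onFinset_subset
      (s := x.support) (f := fun a => polyProj k n (e - dA a) (x a))
      (hf := fun a ha => by
        rw [Finsupp.mem_support_iff]; intro h; exact ha (by rw [h, map_zero]))
    rw [Finset.sum_subset hsub]
    · refine Finset.sum_congr rfl fun a _ => ?_
      rw [polyProj_mul _ (hf a b), Finsupp.onFinset_apply]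
      congr 3
      ring
    · intro a _ ha
      rw [Finsupp.notMem_support_iff.mp ha, zero_mul]

/-- Graded free modules are projective with respect to homogeneous maps. -/
theorem IsHomog.exists_lift (hf : IsHomog dA dB f)
    {g : (C →₀ MvPolynomial (Fin n) k) →ₗ[MvPolynomial (Fin n) k] (B →₀ MvPolynomial (Fin n) k)}
    (hg : IsHomog dC dB g) (h : LinearMap.range f ≤ LinearMap.range g) :
    ∃ φ : (A →₀ MvPolynomial (Fin n) k) →ₗ[MvPolynomial (Fin n) k] (C →₀ MvPolynomial (Fin n) k),
      IsHomog dA dC φ ∧ g ∘ₗ φ = f := by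
  choose c hc hgc using fun a => hg.exists_preimage (hf a) (h ⟨_, rfl⟩)
  have hφ (a : A) : Finsupp.linearCombination (MvPolynomial (Fin n) k) c (Finsupp.single a 1)
      = c a := by simp
  refine ⟨Finsupp.linearCombination _ c, fun a => by rw [hφ]; exact hc a, ?_⟩
  refine Finsupp.lhom_ext' fun a => LinearMap.ext_ring ?_
  simp only [LinearMap.comp_apply, Finsupp.lsingle_apply, hφ, hgc]

end Homog

/-! ### Exact complexes of graded free modules -/

/-- Dependent choice along a family of types: `P` is the invariant that makes the next choice
possible. Chain maps and homotopies are both built this way. -/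
theorem exists_dependent_seq {α : ℕ → Type*} (P : ∀ i, α i → Prop)
    (R : ∀ i, α i → α (i + 1) → Prop) (a₀ : α 0) (h₀ : P 0 a₀)
    (step : ∀ i a, P i a → ∃ a', P (i + 1) a' ∧ R i a a') :
    ∃ f : ∀ i, α i, f 0 = a₀ ∧ (∀ i, P i (f i)) ∧ ∀ i, R i (f i) (f (i + 1)) := by
  choose s hs hR using step
  let f : ∀ i, {a : α i // P i a} :=
    fun i => Nat.rec ⟨a₀, h₀⟩ (fun i a => ⟨s i a.1 a.2, hs i a.1 a.2⟩) i
  exact ⟨fun i => (f i).1, rfl, fun i => (f i).2, fun i => hR i _ _⟩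

variable (k n) in
/-- An exact sequence `⋯ → F_2 → F_1 → F_0` of graded free modules and homogeneous maps. -/
structure FreeComplex where
  B : ℕ → Type u
  deg : ∀ i, B i → ℤ
  d : ∀ i, (B (i + 1) →₀ MvPolynomial (Fin n) k) →ₗ[MvPolynomial (Fin n) k]
    (B i →₀ MvPolynomial (Fin n) k)
  homog : ∀ i, IsHomog (deg (i + 1)) (deg i) (d i)
  exact : ∀ i, Function.Exact (d (i + 1)) (d i)

namespace FreeComplex

/-- The `i`-th term of an exact sequence of graded free modules. -/
abbrev Term (X : FreeComplex k n) (i : ℕ) : Type u := X.B i →₀ MvPolynomial (Fin n) k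

theorem d_d (X : FreeComplex k n) (i : ℕ) (x : X.Term (i + 2)) : X.d i (X.d (i + 1) x) = 0 :=
  (X.exact i).apply_apply_eq_zero x

/-- The invariant is that `φ i ∘ X.d i` lands in the range of `Y.d i`. A lift then exists by
freeness, and exactness of `Y` restores the invariant one step up. -/
theorem exists_chainMap (X Y : FreeComplex k n)
    (φ₀ : X.Term 0 →ₗ[MvPolynomial (Fin n) k] Y.Term 0) (h₀ : IsHomog (X.deg 0) (Y.deg 0) φ₀)
    (h : LinearMap.range (φ₀ ∘ₗ X.d 0) ≤ LinearMap.range (Y.d 0)) :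
    ∃ φ : ∀ i, X.Term i →ₗ[MvPolynomial (Fin n) k] Y.Term i, φ 0 = φ₀ ∧
      (∀ i, IsHomog (X.deg i) (Y.deg i) (φ i)) ∧ ∀ i, Y.d i ∘ₗ φ (i + 1) = φ i ∘ₗ X.d i := by
  obtain ⟨φ, hφ₀, hP, hR⟩ := exists_dependent_seq
    (α := fun i => X.Term i →ₗ[MvPolynomial (Fin n) k] Y.Term i)
    (fun i φ => IsHomog (X.deg i) (Y.deg i) φ ∧
      LinearMap.range (φ ∘ₗ X.d i) ≤ LinearMap.range (Y.d i))
    (fun i φ φ' => Y.d i ∘ₗ φ' = φ ∘ₗ X.d i) φ₀ ⟨h₀, h⟩ (by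
      rintro i φ ⟨h1, h2⟩
      obtain ⟨φ', h3, h4⟩ := (h1.comp (X.homog i)).exists_lift (Y.homog i) h2
      refine ⟨φ', ⟨h3, ?_⟩, h4⟩
      rintro _ ⟨x, rfl⟩
      refine (Y.exact i _).mp ?_
      have := LinearMap.congr_fun h4 (X.d (i + 1) x)
      simpa [X.d_d] using this)
  exact ⟨φ, hφ₀, fun i => (hP i).1, hR⟩

/-- The map `θ (i + 1) - h i ∘ X.d i` takes values in cycles of `Y` as soon as `Y.d i ∘ h i` and `θ
i` agree on the image of `X.d i`; lifting it through `Y.d (i + 1)` gives the next homotopy with the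
same property. -/
theorem exists_homotopy (X Y : FreeComplex k n)
    (θ : ∀ i, X.Term i →ₗ[MvPolynomial (Fin n) k] Y.Term i) (h₀ : θ 0 = 0)
    (hθ : ∀ i, IsHomog (X.deg i) (Y.deg i) (θ i))
    (hcomm : ∀ i, Y.d i ∘ₗ θ (i + 1) = θ i ∘ₗ X.d i) :
    ∃ h : ∀ i, X.Term i →ₗ[MvPolynomial (Fin n) k] Y.Term (i + 1), h 0 = 0 ∧
      (∀ i, IsHomog (X.deg i) (Y.deg (i + 1)) (h i)) ∧
      ∀ i, θ (i + 1) = Y.d (i + 1) ∘ₗ h (i + 1) + h i ∘ₗ X.d i := by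
  obtain ⟨h, hh₀, hP, hR⟩ := exists_dependent_seq
    (α := fun i => X.Term i →ₗ[MvPolynomial (Fin n) k] Y.Term (i + 1))
    (fun i h => IsHomog (X.deg i) (Y.deg (i + 1)) h ∧ ∀ x, Y.d i (h (X.d i x)) = θ i (X.d i x))
    (fun i h h' => θ (i + 1) = Y.d (i + 1) ∘ₗ h' + h ∘ₗ X.d i) 0
    ⟨IsHomog.zero, fun x => by simp [h₀]⟩ (by
      rintro i h ⟨h1, h2⟩
      obtain ⟨h', h3, h4⟩ := ((hθ (i + 1)).sub (h1.comp (X.homog i))).exists_lift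
        (Y.homog (i + 1)) (by
          rintro _ ⟨x, rfl⟩
          refine (Y.exact i _).mp ?_
          have := LinearMap.congr_fun (hcomm i) x
          simp only [LinearMap.comp_apply] at this
          simp [h2, this])
      refine ⟨h', ⟨h3, fun x => ?_⟩, ?_⟩
      · have := LinearMap.congr_fun h4 (X.d (i + 1) x)
        simpa [X.d_d] using this
      · exact LinearMap.ext fun x => by simp [h4])
  exact ⟨h, hh₀, fun i => (hP i).1, hR⟩

end FreeComplex

/-! ### Independence of `Tor` of the resolution -/

namespace GradedFreeResolution

variable {I : Ideal (MvPolynomial (Fin n) k)}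

/-- The exact sequence `⋯ → F_1 → F_0 → S` obtained from a resolution `F` of the ideal `I ⊆ S`. -/
noncomputable def toFreeComplex (F : GradedFreeResolution (polyPiece k n) I) :
    FreeComplex k n where
  B
    | 0 => PUnit
    | i + 1 => F.B i
  deg
    | 0 => fun _ => 0
    | i + 1 => F.deg i
  d
    | 0 => Finsupp.lsingle PUnit.unit ∘ₗ I.subtype ∘ₗ F.aug
    | i + 1 => F.d i
  homog
    | 0 => fun b c => by simpa using F.aug_homogeneous b
    | i + 1 => F.d_homogeneous i
  exact
    | 0 => fun x => by
      refine Iff.trans ?_ (F.exact_zero x)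
      simp
    | i + 1 => F.exact_succ i

/-- With `S` added in position 0, the lift can start from the identity of `S`, because both
augmentations have image `I`. -/
theorem exists_chainMap_id (F G : GradedFreeResolution (polyPiece k n) I) :
    ∃ φ : ∀ i, F.toFreeComplex.Term i →ₗ[MvPolynomial (Fin n) k] G.toFreeComplex.Term i,
      φ 0 = LinearMap.id ∧
      (∀ i, IsHomog (F.toFreeComplex.deg i) (G.toFreeComplex.deg i) (φ i)) ∧
      ∀ i, G.toFreeComplex.d i ∘ₗ φ (i + 1) = φ i ∘ₗ F.toFreeComplex.d i := by
  refine FreeComplex.exists_chainMap _ _ _ IsHomog.id ?_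
  rintro _ ⟨x, rfl⟩
  obtain ⟨y, hy⟩ := G.aug_surjective (F.aug x)
  refine ⟨y, ?_⟩
  change Finsupp.single PUnit.unit ((G.aug y : I) : MvPolynomial (Fin n) k) =
    Finsupp.single PUnit.unit ((F.aug x : I) : MvPolynomial (Fin n) k)
  rw [hy]

/-- Two resolutions are comparable by chain maps `φ`, `ψ` with `ψ φ` homotopic to the identity. -/
theorem exists_comparison (F G : GradedFreeResolution (polyPiece k n) I) :
    ∃ (φ : ∀ i, (F.B i →₀ MvPolynomial (Fin n) k) →ₗ[MvPolynomial (Fin n) k]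
          (G.B i →₀ MvPolynomial (Fin n) k))
      (ψ : ∀ i, (G.B i →₀ MvPolynomial (Fin n) k) →ₗ[MvPolynomial (Fin n) k]
          (F.B i →₀ MvPolynomial (Fin n) k))
      (h : ∀ i, (F.B i →₀ MvPolynomial (Fin n) k) →ₗ[MvPolynomial (Fin n) k]
          (F.B (i + 1) →₀ MvPolynomial (Fin n) k)),
      (∀ i, IsHomog (F.deg i) (G.deg i) (φ i)) ∧ (∀ i, IsHomog (G.deg i) (F.deg i) (ψ i)) ∧
      (∀ i, IsHomog (F.deg i) (F.deg (i + 1)) (h i)) ∧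
      (∀ i, G.d i ∘ₗ φ (i + 1) = φ i ∘ₗ F.d i) ∧ (∀ i, F.d i ∘ₗ ψ (i + 1) = ψ i ∘ₗ G.d i) ∧
      ψ 0 ∘ₗ φ 0 = LinearMap.id + F.d 0 ∘ₗ h 0 ∧
      ∀ i, ψ (i + 1) ∘ₗ φ (i + 1) = LinearMap.id + F.d (i + 1) ∘ₗ h (i + 1) + h i ∘ₗ F.d i := by
  obtain ⟨φ, hφ0, hφ, hφd⟩ := exists_chainMap_id F G
  obtain ⟨ψ, hψ0, hψ, hψd⟩ := exists_chainMap_id G F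
  -- Both chain maps are the identity on the added term `S`, so their composite minus the identity
  -- vanishes in position 0.
  obtain ⟨h, hh0, hh, hhd⟩ := FreeComplex.exists_homotopy F.toFreeComplex F.toFreeComplex
    (fun i => ψ i ∘ₗ φ i - LinearMap.id) (by rw [hφ0, hψ0]; exact LinearMap.ext fun x => sub_self x)
    (fun i => ((hψ i).comp (hφ i)).sub IsHomog.id) (by
      intro i
      refine LinearMap.ext fun x => ?_
      have h1 := LinearMap.congr_fun (hψd i) (φ (i + 1) x)
      have h2 := LinearMap.congr_fun (hφd i) x
      simp only [LinearMap.comp_apply] at h1 h2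
      simp [h1, h2])
  refine ⟨fun i => φ (i + 1), fun i => ψ (i + 1), fun i => h (i + 1), fun i => hφ (i + 1),
    fun i => hψ (i + 1), fun i => hh (i + 1), fun i => hφd (i + 1), fun i => hψd (i + 1), ?_, fun i => ?_⟩
  -- Dropping the added term shifts all indices by one; here the term `h 0 ∘ d` disappears because
  -- `h 0 = 0`.
  · refine LinearMap.ext fun x => ?_
    have := LinearMap.congr_fun (hhd 0) x
    rw [hh0] at this
    exact sub_eq_iff_eq_add'.mp (this.trans (add_zero _))
  · refine LinearMap.ext fun x => ?_
    have := LinearMap.congr_fun (hhd (i + 1)) x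
    exact (sub_eq_iff_eq_add'.mp this).trans (add_assoc _ _ _).symm

variable (𝔪 : Ideal (MvPolynomial (Fin n) k))

/-- The `k`-linear map `(S/𝔪) ⊗ f`. -/
noncomputable def tensorMap {A B : Type u}
    (f : (A →₀ MvPolynomial (Fin n) k) →ₗ[MvPolynomial (Fin n) k] (B →₀ MvPolynomial (Fin n) k)) :
    (MvPolynomial (Fin n) k ⧸ 𝔪) ⊗[MvPolynomial (Fin n) k] (A →₀ MvPolynomial (Fin n) k) →ₗ[k]
    (MvPolynomial (Fin n) k ⧸ 𝔪) ⊗[MvPolynomial (Fin n) k] (B →₀ MvPolynomial (Fin n) k) :=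
  (f.lTensor (MvPolynomial (Fin n) k ⧸ 𝔪)).restrictScalars k

theorem tensorMap_comp {A B C : Type u}
    (g : (B →₀ MvPolynomial (Fin n) k) →ₗ[MvPolynomial (Fin n) k] (C →₀ MvPolynomial (Fin n) k))
    (f : (A →₀ MvPolynomial (Fin n) k) →ₗ[MvPolynomial (Fin n) k] (B →₀ MvPolynomial (Fin n) k))
    (z) : tensorMap 𝔪 g (tensorMap 𝔪 f z) = tensorMap 𝔪 (g ∘ₗ f) z :=
  (LinearMap.lTensor_comp_apply _ g f z).symm

theorem tensorMap_add {A B : Type u}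
    (f g : (A →₀ MvPolynomial (Fin n) k) →ₗ[MvPolynomial (Fin n) k] (B →₀ MvPolynomial (Fin n) k))
    (z) : tensorMap 𝔪 (f + g) z = tensorMap 𝔪 f z + tensorMap 𝔪 g z :=
  LinearMap.congr_fun (LinearMap.lTensor_add (MvPolynomial (Fin n) k ⧸ 𝔪) f g) z

theorem tensorMap_id {A : Type u} (z) :
    tensorMap 𝔪 (LinearMap.id : (A →₀ MvPolynomial (Fin n) k) →ₗ[MvPolynomial (Fin n) k]
      (A →₀ MvPolynomial (Fin n) k)) z = z :=
  LinearMap.congr_fun (LinearMap.lTensor_id (MvPolynomial (Fin n) k ⧸ 𝔪) _) z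

theorem tensorMap_mem_tensorPiece {F G : GradedFreeResolution (polyPiece k n) I} {i j : ℕ}
    {f : (F.B i →₀ MvPolynomial (Fin n) k) →ₗ[MvPolynomial (Fin n) k]
      (G.B j →₀ MvPolynomial (Fin n) k)} (hf : IsHomog (F.deg i) (G.deg j) f) {e : ℤ}
    {z : F.TensorTerm 𝔪 i} (hz : z ∈ F.tensorPiece 𝔪 i e) :
    tensorMap 𝔪 f z ∈ G.tensorPiece 𝔪 j e := by
  obtain ⟨x, hx, rfl⟩ := hz
  exact ⟨f x, hf.map_mem hx, (LinearMap.lTensor_tmul _ _ _ _).symm⟩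

/-- The map induced by `φ` on homology is injective: if `φ z` is a boundary, so is `ψ (φ z)`, which
differs from `z` by a boundary. Exchanging the resolutions gives the reverse inequality, so the
homotopy for `φ ψ` is not needed. -/
theorem rank_Tor_le (F G : GradedFreeResolution (polyPiece k n) I) (i : ℕ) (e : ℤ) :
    Module.rank k (F.Tor 𝔪 i e) ≤ Module.rank k (G.Tor 𝔪 i e) := by
  obtain ⟨φ, ψ, h, hφ, hψ, hh, hφd, hψd, h0, hs⟩ := exists_comparison F G
  -- Stated for an arbitrary pair of resolutions, since it serves both for `φ` and for `ψ`.
  have hbdry {F G : GradedFreeResolution (polyPiece k n) I}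
      {φ : ∀ i, (F.B i →₀ MvPolynomial (Fin n) k) →ₗ[MvPolynomial (Fin n) k]
          (G.B i →₀ MvPolynomial (Fin n) k)} (hφ : ∀ i, IsHomog (F.deg i) (G.deg i) (φ i))
      (hφd : ∀ i, G.d i ∘ₗ φ (i + 1) = φ i ∘ₗ F.d i) :
      F.boundaries 𝔪 i e ≤ (G.boundaries 𝔪 i e).comap (tensorMap 𝔪 (φ i)) := by
    rintro _ ⟨w, hw, rfl⟩
    refine ⟨tensorMap 𝔪 (φ (i + 1)) w, tensorMap_mem_tensorPiece 𝔪 (hφ _) hw, ?_⟩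
    change tensorMap 𝔪 (G.d i) _ = tensorMap 𝔪 (φ i) (tensorMap 𝔪 (F.d i) w)
    rw [tensorMap_comp, tensorMap_comp, hφd]
  have hcyc : ∀ z ∈ F.cycles 𝔪 i e, tensorMap 𝔪 (φ i) z ∈ G.cycles 𝔪 i e := by
    intro z hz
    cases i with
    | zero => exact tensorMap_mem_tensorPiece 𝔪 (hφ _) hz
    | succ i =>
      refine ⟨tensorMap_mem_tensorPiece 𝔪 (hφ _) hz.1, ?_⟩
      have hz2 : tensorMap 𝔪 (F.d i) z = 0 := hz.2
      change tensorMap 𝔪 (G.d i) (tensorMap 𝔪 (φ (i + 1)) z) = 0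
      rw [tensorMap_comp, hφd, ← tensorMap_comp, hz2, map_zero]
  have hhom : ∀ z ∈ F.cycles 𝔪 i e,
      tensorMap 𝔪 (ψ i) (tensorMap 𝔪 (φ i) z) - z ∈ F.boundaries 𝔪 i e := by
    intro z hz
    rw [tensorMap_comp]
    cases i with
    | zero =>
      rw [h0, tensorMap_add, tensorMap_id, add_sub_cancel_left, ← tensorMap_comp]
      exact ⟨_, tensorMap_mem_tensorPiece 𝔪 (hh _) hz, rfl⟩
    | succ i =>
      have hz2 : tensorMap 𝔪 (F.d i) z = 0 := hz.2
      rw [hs, tensorMap_add, tensorMap_add, tensorMap_id, ← tensorMap_comp, ← tensorMap_comp, hz2,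
        map_zero, add_zero, add_sub_cancel_left]
      exact ⟨_, tensorMap_mem_tensorPiece 𝔪 (hh _) hz.1, rfl⟩
  let Φ := (F.boundaries 𝔪 i e).mapQ (G.boundaries 𝔪 i e) (tensorMap 𝔪 (φ i)) (hbdry hφ hφd)
  have hΦ : ∀ x : F.Tor 𝔪 i e, Φ.domRestrict (F.Tor 𝔪 i e) x ∈ G.Tor 𝔪 i e := by
    rintro ⟨_, z, hz, rfl⟩
    exact ⟨_, hcyc z hz, rfl⟩
  refine LinearMap.rank_le_of_injective
    ((Φ.domRestrict (F.Tor 𝔪 i e)).codRestrict (G.Tor 𝔪 i e) hΦ) ?_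
  rw [injective_iff_map_eq_zero]
  rintro ⟨_, z, hz, rfl⟩ hx
  have hx' : Φ ((F.boundaries 𝔪 i e).mkQ z) = 0 := congrArg Subtype.val hx
  have h1 : tensorMap 𝔪 (φ i) z ∈ G.boundaries 𝔪 i e := (Submodule.Quotient.mk_eq_zero _).mp hx'
  have h2 := hbdry hψ hψd h1
  refine Subtype.ext ((Submodule.Quotient.mk_eq_zero _).mpr ?_)
  have := Submodule.sub_mem (F.boundaries 𝔪 i e) h2 (hhom z hz)
  rwa [sub_sub_cancel] at this

/-! ### Betti numbers from a minimal resolution -/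

/-- All matrix entries lie in `𝔪`, so the differentials vanish after tensoring with `S/𝔪`, and `Tor`
is the whole degree `e` piece of `(S/𝔪) ⊗ F_i`. The vectors `1 ⊗ b` with `deg b = e` form a basis of
that piece. -/
theorem rank_Tor_of_minimal (F : GradedFreeResolution (polyPiece k n) I)
    (hF : ∀ i b c, (F.d i (Finsupp.single b 1) c).coeff 0 = 0) (i : ℕ) (e : ℤ) :
    Module.rank k (F.Tor (MvPolynomial.idealOfVars (Fin n) k) i e) =
      Cardinal.mk {b : F.B i // F.deg i b = e} := by
  classical
  set 𝔪 := MvPolynomial.idealOfVars (Fin n) k with h𝔪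
  have hmem (f : MvPolynomial (Fin n) k) (hf : f.coeff 0 = 0) : f ∈ 𝔪 := by
    rw [h𝔪, MvPolynomial.idealOfVars, ← Set.image_univ, MvPolynomial.mem_ideal_span_X_image]
    intro m hm
    by_contra! h
    have : m = 0 := Finsupp.ext fun i => h i (Set.mem_univ i)
    rw [this] at hm
    exact MvPolynomial.mem_support_iff.mp hm hf
  have hne : (1 : MvPolynomial (Fin n) k) ∉ 𝔪 := by
    rw [h𝔪, MvPolynomial.idealOfVars, ← Set.image_univ, MvPolynomial.mem_ideal_span_X_image]
    intro h
    obtain ⟨i, _, hi⟩ := h 0 (MvPolynomial.mem_support_iff.mpr (by simp))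
    exact hi rfl
  have hsmul (f : MvPolynomial (Fin n) k) (hf : f.coeff 0 = 0)
      (t : MvPolynomial (Fin n) k ⧸ 𝔪) : f • t = 0 := by
    obtain ⟨t, rfl⟩ := Ideal.Quotient.mk_surjective t
    exact Ideal.Quotient.eq_zero_iff_mem.mpr (Ideal.mul_mem_right t 𝔪 (hmem f hf))
  have htmul (j : ℕ) (t : MvPolynomial (Fin n) k ⧸ 𝔪) (x : F.B j →₀ MvPolynomial (Fin n) k) :
      t ⊗ₜ[MvPolynomial (Fin n) k] x = ∑ b ∈ x.support,
        (x b • t) ⊗ₜ[MvPolynomial (Fin n) k] Finsupp.single b (1 : MvPolynomial (Fin n) k) := by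
    conv_lhs => rw [← Finsupp.sum_single x, Finsupp.sum, TensorProduct.tmul_sum]
    refine Finset.sum_congr rfl fun b _ => ?_
    rw [← Finsupp.smul_single_one, TensorProduct.tmul_smul, TensorProduct.smul_tmul']
  have hd (j : ℕ) : F.tensorD 𝔪 j = 0 := by
    ext z
    change (F.d j).lTensor (MvPolynomial (Fin n) k ⧸ 𝔪) z = 0
    induction z using TensorProduct.induction_on with
    | zero => exact map_zero _
    | add x y hx hy => rw [map_add, hx, hy, add_zero]
    | tmul t x =>
      rw [LinearMap.lTensor_tmul, htmul]
      refine Finset.sum_eq_zero fun b _ => ?_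
      rw [hsmul _ _, TensorProduct.zero_tmul]
      rw [map_eq_sum, MvPolynomial.coeff_sum]
      refine Finset.sum_eq_zero fun c _ => ?_
      rw [← MvPolynomial.constantCoeff_eq, map_mul, MvPolynomial.constantCoeff_eq, hF, mul_zero]
  have hb : F.boundaries 𝔪 i e = ⊥ := by
    rw [boundaries, hd, Submodule.map_zero]
  have hc : F.cycles 𝔪 i e = F.tensorPiece 𝔪 i e := by
    cases i with
    | zero => rfl
    | succ i => rw [cycles, hd, LinearMap.ker_zero, inf_top_eq]
  have hinj : Function.Injective (F.boundaries 𝔪 i e).mkQ := by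
    rw [← LinearMap.ker_eq_bot, Submodule.ker_mkQ, hb]
  have hrank : Module.rank k (F.Tor 𝔪 i e) = Module.rank k (F.tensorPiece 𝔪 i e) := by
    rw [Tor, hc]
    exact (Submodule.equivMapOfInjective _ hinj _).rank_eq.symm
  let v : {b : F.B i // F.deg i b = e} → F.TensorTerm 𝔪 i :=
    fun b => 1 ⊗ₜ[MvPolynomial (Fin n) k] Finsupp.single b.1 1
  have hv : LinearIndependent k v := by
    rw [linearIndependent_iff']
    intro s g hg b hb
    -- `L` reads off the coordinate at `b` under `(S/𝔪) ⊗ (B →₀ S) ≃ (B →₀ S/𝔪)`.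
    let L : F.TensorTerm 𝔪 i →ₗ[k] MvPolynomial (Fin n) k ⧸ 𝔪 :=
      (Finsupp.lapply b.1 ∘ₗ (TensorProduct.finsuppScalarRight (MvPolynomial (Fin n) k)
        (MvPolynomial (Fin n) k) (MvPolynomial (Fin n) k ⧸ 𝔪) (F.B i)).toLinearMap).restrictScalars k
    have hL (c : {b : F.B i // F.deg i b = e}) : L (v c) = if c = b then 1 else 0 := by
      refine (TensorProduct.finsuppScalarRight_apply_tmul_apply _ _ _).trans ?_
      rw [Finsupp.single_apply]
      by_cases h : c = b
      · rw [if_pos (congrArg Subtype.val h), if_pos h, one_smul]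
      · rw [if_neg (fun h' => h (Subtype.ext h')), if_neg h, zero_smul]
    have h1 := congrArg L hg
    simp only [map_sum, map_smul, map_zero, hL, smul_ite, smul_zero, Finset.sum_ite_eq', hb, if_true] at h1
    have : Nontrivial (MvPolynomial (Fin n) k ⧸ 𝔪) :=
      Ideal.Quotient.nontrivial_iff.mpr fun h => hne (h ▸ Submodule.mem_top)
    exact (smul_eq_zero.mp h1).resolve_right one_ne_zero
  have hspan : F.tensorPiece 𝔪 i e = Submodule.span k (Set.range v) := by
    refine le_antisymm ?_ (Submodule.span_le.mpr ?_)
    · rintro _ ⟨x, hx, rfl⟩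
      change 1 ⊗ₜ[MvPolynomial (Fin n) k] x ∈ _
      rw [htmul]
      refine Submodule.sum_mem _ fun b _ => ?_
      -- A coordinate in degree zero acts on `S/𝔪` through its constant term; one in nonzero degree
      -- has no constant term and acts as zero.
      by_cases h : F.deg i b = e
      · have h1 : (x b - MvPolynomial.C ((x b).coeff 0)).coeff 0 = 0 := by simp
        have h2 : x b • (1 : MvPolynomial (Fin n) k ⧸ 𝔪) = (x b).coeff 0 • 1 := by
          have := hsmul _ h1 1
          rw [sub_smul, sub_eq_zero] at this
          rw [this, ← MvPolynomial.algebraMap_eq, algebraMap_smul]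
        rw [h2, ← TensorProduct.smul_tmul']
        exact Submodule.smul_mem _ _ (Submodule.subset_span ⟨⟨b, h⟩, rfl⟩)
      · rw [hsmul _ (coeff_zero_of_mem_polyPiece (sub_ne_zero.mpr (Ne.symm h)) (hx b)),
          TensorProduct.zero_tmul]
        exact Submodule.zero_mem _
    · rintro _ ⟨b, rfl⟩
      refine ⟨_, ?_, rfl⟩
      have := single_mem_freePiece (k := k) (n := n) (F.deg i) b.1
      rwa [b.2] at this
  rw [hrank, hspan, rank_span hv, Cardinal.mk_range_eq _ hv.injective]

end GradedFreeResolution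

/-! ### Mapping cones -/

namespace FreeComplex

/-- The exact sequence `K(-c)`. -/
def shift (K : FreeComplex k n) (c : ℤ) : FreeComplex k n where
  B := K.B
  deg i b := K.deg i b + c
  d := K.d
  homog i a b := by
    simpa using K.homog i a b
  exact := K.exact

/-- A chain map `K(-t) → X` which is injective on the cokernels of the last maps, so that its mapping
cone is exact. -/
structure ConeData (X K : FreeComplex k n) (t : ℤ) where
  φ : ∀ i, K.Term i →ₗ[MvPolynomial (Fin n) k] X.Term i
  homog : ∀ i, IsHomog (fun b => K.deg i b + t) (X.deg i) (φ i)
  comm : ∀ i, X.d i ∘ₗ φ (i + 1) = φ i ∘ₗ K.d i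
  inj : ∀ y, φ 0 y ∈ LinearMap.range (X.d 0) → y ∈ LinearMap.range (K.d 0)

variable (k n) in
/-- Splitting of a free module on a disjoint union. -/
noncomputable abbrev splitSum (A B : Type u) :
    (A ⊕ B →₀ MvPolynomial (Fin n) k) ≃ₗ[MvPolynomial (Fin n) k]
      (A →₀ MvPolynomial (Fin n) k) × (B →₀ MvPolynomial (Fin n) k) :=
  Finsupp.sumFinsuppLEquivProdFinsupp (MvPolynomial (Fin n) k)

theorem splitSum_single_inl {A B : Type u} (a : A) (r : MvPolynomial (Fin n) k) :
    splitSum k n A B (Finsupp.single (Sum.inl a) r) = (Finsupp.single a r, 0) := by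
  classical
  refine Prod.ext (Finsupp.ext fun b => ?_) (Finsupp.ext fun b => ?_)
  · simp [Finsupp.single_apply]
  · simp

theorem splitSum_single_inr {A B : Type u} (b : B) (r : MvPolynomial (Fin n) k) :
    splitSum k n A B (Finsupp.single (Sum.inr b) r) = (0, Finsupp.single b r) := by
  classical
  refine Prod.ext (Finsupp.ext fun b => ?_) (Finsupp.ext fun b => ?_)
  · simp
  · simp [Finsupp.single_apply]

namespace ConeData

variable {X K : FreeComplex k n} {t : ℤ} (D : ConeData X K t)

/-- The last differential of the mapping cone. -/
noncomputable def dZero : (X.B 1 ⊕ K.B 0 →₀ MvPolynomial (Fin n) k) →ₗ[MvPolynomial (Fin n) k]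
    (X.B 0 →₀ MvPolynomial (Fin n) k) :=
  ((X.d 0).coprod (D.φ 0)) ∘ₗ (splitSum k n (X.B 1) (K.B 0)).toLinearMap

/-- The other differentials of the mapping cone. -/
noncomputable def dSucc (i : ℕ) :
    (X.B (i + 2) ⊕ K.B (i + 1) →₀ MvPolynomial (Fin n) k) →ₗ[MvPolynomial (Fin n) k]
    (X.B (i + 1) ⊕ K.B i →₀ MvPolynomial (Fin n) k) :=
  (splitSum k n (X.B (i + 1)) (K.B i)).symm.toLinearMap ∘ₗ
    (((X.d (i + 1)).coprod (D.φ (i + 1))).prod (-(K.d i ∘ₗ LinearMap.snd _ _ _))) ∘ₗ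
    (splitSum k n (X.B (i + 2)) (K.B (i + 1))).toLinearMap

theorem dZero_symm_apply (x : X.Term 1) (y : K.Term 0) :
    D.dZero ((splitSum k n (X.B 1) (K.B 0)).symm (x, y)) = X.d 0 x + D.φ 0 y := by
  simp [dZero, splitSum]

theorem dSucc_symm_apply (i : ℕ) (x : X.Term (i + 2)) (y : K.Term (i + 1)) :
    D.dSucc i ((splitSum k n (X.B (i + 2)) (K.B (i + 1))).symm (x, y)) =
      (splitSum k n (X.B (i + 1)) (K.B i)).symm
        (X.d (i + 1) x + D.φ (i + 1) y, -K.d i y) := by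
  simp [dSucc, splitSum]

theorem dZero_inl (a : X.B 1) :
    D.dZero (Finsupp.single (Sum.inl a) 1) = X.d 0 (Finsupp.single a 1) := by
  have := D.dZero_symm_apply (Finsupp.single a 1) 0
  rwa [← splitSum_single_inl, LinearEquiv.symm_apply_apply, map_zero, add_zero] at this

theorem dZero_inr (a : K.B 0) :
    D.dZero (Finsupp.single (Sum.inr a) 1) = D.φ 0 (Finsupp.single a 1) := by
  have := D.dZero_symm_apply 0 (Finsupp.single a 1)
  rwa [← splitSum_single_inr, LinearEquiv.symm_apply_apply, map_zero, zero_add] at this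

theorem dSucc_inl (i : ℕ) (a : X.B (i + 2)) :
    D.dSucc i (Finsupp.single (Sum.inl a) 1) =
      (splitSum k n (X.B (i + 1)) (K.B i)).symm (X.d (i + 1) (Finsupp.single a 1), 0) := by
  have := D.dSucc_symm_apply i (Finsupp.single a 1) 0
  rwa [← splitSum_single_inl, LinearEquiv.symm_apply_apply, map_zero, map_zero, add_zero,
    neg_zero] at this

theorem dSucc_inr (i : ℕ) (a : K.B (i + 1)) :
    D.dSucc i (Finsupp.single (Sum.inr a) 1) = (splitSum k n (X.B (i + 1)) (K.B i)).symm
      (D.φ (i + 1) (Finsupp.single a 1), -K.d i (Finsupp.single a 1)) := by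
  have := D.dSucc_symm_apply i 0 (Finsupp.single a 1)
  rwa [← splitSum_single_inr, LinearEquiv.symm_apply_apply, map_zero, zero_add] at this

theorem comm_apply (i : ℕ) (y : K.Term (i + 1)) :
    X.d i (D.φ (i + 1) y) = D.φ i (K.d i y) :=
  LinearMap.congr_fun (D.comm i) y

/-- The mapping cone. -/
noncomputable def cone : FreeComplex k n where
  B
    | 0 => X.B 0
    | i + 1 => X.B (i + 1) ⊕ K.B i
  deg
    | 0 => X.deg 0
    | i + 1 => Sum.elim (X.deg (i + 1)) (fun b => K.deg i b + t)
  d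
    | 0 => D.dZero
    | i + 1 => D.dSucc i
  homog
    | 0 => by
      rintro (a | a)
      · rw [dZero_inl]; exact X.homog 0 a
      · rw [dZero_inr]; exact D.homog 0 a
    | i + 1 => by
      rintro (a | a) (b | b)
      · rw [dSucc_inl, Finsupp.sumFinsuppLEquivProdFinsupp_symm_inl]
        exact X.homog (i + 1) a b
      · rw [dSucc_inl, Finsupp.sumFinsuppLEquivProdFinsupp_symm_inr]
        exact Submodule.zero_mem _
      · rw [dSucc_inr, Finsupp.sumFinsuppLEquivProdFinsupp_symm_inl]
        exact D.homog (i + 1) a b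
      · rw [dSucc_inr, Finsupp.sumFinsuppLEquivProdFinsupp_symm_inr]
        have := Submodule.neg_mem _ (K.homog i a b)
        change _ ∈ polyPiece k n (K.deg (i + 1) a + t - (K.deg i b + t))
        rwa [add_sub_add_right_eq_sub]
  exact
    | 0 => by
      intro z
      obtain ⟨⟨x, y⟩, rfl⟩ := (splitSum k n (X.B 1) (K.B 0)).symm.surjective z
      constructor
      · intro h
        change D.dZero _ = 0 at h
        rw [dZero_symm_apply] at h
        -- The relation `d x + φ y = 0` puts `φ y` in the range of `X.d 0`, so `y = d y'`. Then `x +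
        -- φ y'` is a cycle of `X`, hence some `d x'`, and the preimage is `(x', -y')`.
        obtain ⟨y', rfl⟩ := D.inj y ⟨-x, by rw [map_neg]; exact neg_eq_of_add_eq_zero_right h⟩
        obtain ⟨x', hx'⟩ := (X.exact 0 (x + D.φ 1 y')).mp (by rw [map_add, comm_apply, h])
        refine ⟨(splitSum k n (X.B 2) (K.B 1)).symm (x', -y'), ?_⟩
        change D.dSucc 0 _ = _
        rw [dSucc_symm_apply, map_neg, map_neg, neg_neg]
        erw [hx']
        rw [add_neg_cancel_right]
      · rintro ⟨w, hw⟩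
        change X.B 2 ⊕ K.B 1 →₀ MvPolynomial (Fin n) k at w
        obtain ⟨⟨x', y'⟩, rfl⟩ := (splitSum k n (X.B 2) (K.B 1)).symm.surjective w
        change D.dSucc 0 _ = _ at hw
        change D.dZero _ = 0
        rw [← hw, dSucc_symm_apply, dZero_symm_apply, map_add, X.d_d, comm_apply, map_neg, zero_add,
          add_neg_cancel]
    | i + 1 => by
      intro z
      obtain ⟨⟨x, y⟩, rfl⟩ := (splitSum k n (X.B (i + 2)) (K.B (i + 1))).symm.surjective z
      constructor
      · intro h
        change D.dSucc i _ = 0 at h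
        rw [dSucc_symm_apply, LinearEquiv.map_eq_zero_iff, Prod.mk_eq_zero, neg_eq_zero] at h
        obtain ⟨y', rfl⟩ := (K.exact i y).mp h.2
        obtain ⟨x', hx'⟩ := (X.exact (i + 1) (x + D.φ (i + 2) y')).mp
          (by rw [map_add, comm_apply, h.1])
        refine ⟨(splitSum k n (X.B (i + 3)) (K.B (i + 2))).symm (x', -y'), ?_⟩
        change D.dSucc (i + 1) _ = _
        rw [dSucc_symm_apply, map_neg, map_neg, neg_neg]
        erw [hx']
        rw [add_neg_cancel_right]
      · rintro ⟨w, hw⟩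
        change X.B (i + 3) ⊕ K.B (i + 2) →₀ MvPolynomial (Fin n) k at w
        obtain ⟨⟨x', y'⟩, rfl⟩ := (splitSum k n (X.B (i + 3)) (K.B (i + 2))).symm.surjective w
        change D.dSucc (i + 1) _ = _ at hw
        change D.dSucc i _ = 0
        rw [← hw, dSucc_symm_apply, dSucc_symm_apply, map_add, X.d_d, comm_apply, map_neg, map_neg,
          K.d_d, zero_add, add_neg_cancel, neg_zero, neg_zero]
        exact map_zero _

theorem coeff_dSucc (i : ℕ) (hX : ∀ a b, (X.d (i + 1) (Finsupp.single a 1) b).coeff 0 = 0)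
    (hK : ∀ a b, (K.d i (Finsupp.single a 1) b).coeff 0 = 0)
    (hφ : ∀ a b, (D.φ (i + 1) (Finsupp.single a 1) b).coeff 0 = 0) (a b) :
    (D.dSucc i (Finsupp.single a 1) b).coeff 0 = 0 := by
  obtain a | a := a <;> obtain b | b := b
  · rw [dSucc_inl, Finsupp.sumFinsuppLEquivProdFinsupp_symm_inl]
    exact hX a b
  · rw [dSucc_inl, Finsupp.sumFinsuppLEquivProdFinsupp_symm_inr]
    exact MvPolynomial.coeff_zero _
  · rw [dSucc_inr, Finsupp.sumFinsuppLEquivProdFinsupp_symm_inl]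
    exact hφ a b
  · rw [dSucc_inr, Finsupp.sumFinsuppLEquivProdFinsupp_symm_inr, Finsupp.neg_apply,
      MvPolynomial.coeff_neg, neg_eq_zero]
    exact hK a b

end ConeData

/-! ### Resolutions of quotient rings and Koszul complexes -/

/-- `X` is a resolution of `S/J`, with `F_0 = S` generated by the basis vector `b`. -/
structure Resolves (X : FreeComplex k n) (J : Ideal (MvPolynomial (Fin n) k)) (b : X.B 0) :
    Prop where
  eq_base : ∀ c, c = b
  deg_base : X.deg 0 b = 0
  mem_range : ∀ f, Finsupp.single b f ∈ LinearMap.range (X.d 0) ↔ f ∈ J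

theorem Resolves.single_base {X : FreeComplex k n} {J : Ideal (MvPolynomial (Fin n) k)} {b : X.B 0}
    (hX : X.Resolves J b) (x : X.Term 0) : Finsupp.single b (x b) = x := by
  ext1 c
  rw [hX.eq_base c, Finsupp.single_eq_same]

theorem Resolves.apply_mem {X : FreeComplex k n} {J : Ideal (MvPolynomial (Fin n) k)} {b : X.B 0}
    (hX : X.Resolves J b) (x : X.Term 1) : X.d 0 x b ∈ J := by
  rw [← hX.mem_range, hX.single_base]
  exact ⟨x, rfl⟩

/-- A resolution of `S/(J + (x^u))` from resolutions of `S/J` and `S/(J : x^u)`. -/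
theorem Resolves.exists_coneData {X K : FreeComplex k n} {J J' : Ideal (MvPolynomial (Fin n) k)}
    {b : X.B 0} {c : K.B 0} (hX : X.Resolves J b) (hK : K.Resolves J' c) (u : Fin n →₀ ℕ)
    (hcolon : ∀ f, f ∈ J' ↔ MvPolynomial.monomial u (1 : k) * f ∈ J) :
    ∃ D : ConeData X K u.degree,
      D.cone.Resolves (J ⊔ Ideal.span {MvPolynomial.monomial u (1 : k)}) b := by
  classical
  set p := MvPolynomial.monomial u (1 : k)
  -- Multiplication by `x^u` induces an injection of `S/(J : x^u)` into `S/J` with cokernel `S/(J +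
  -- (x^u))`; the cone of a lift resolves that cokernel.
  let φ₀ : K.Term 0 →ₗ[MvPolynomial (Fin n) k] X.Term 0 :=
    Finsupp.lsingle b ∘ₗ LinearMap.mulLeft (MvPolynomial (Fin n) k) p ∘ₗ Finsupp.lapply c
  have hφ₀ (y : K.Term 0) : φ₀ y = Finsupp.single b (p * y c) := rfl
  have hhom : IsHomog (fun b => K.deg 0 b + u.degree) (X.deg 0) φ₀ := by
    intro a a'
    obtain rfl := hK.eq_base a
    obtain rfl := hX.eq_base a'
    rw [hφ₀, Finsupp.single_eq_same, Finsupp.single_eq_same, mul_one]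
    beta_reduce
    rw [hK.deg_base, hX.deg_base, zero_add, sub_zero]
    exact monomial_mem_polyPiece u 1
  obtain ⟨φ, h0, hφ, hφd⟩ := exists_chainMap (K.shift u.degree) X φ₀ hhom (by
    rintro _ ⟨x, rfl⟩
    exact (hX.mem_range _).mpr ((hcolon _).mp (hK.apply_mem x)))
  change ∀ i, K.Term i →ₗ[MvPolynomial (Fin n) k] X.Term i at φ
  have h0' (y : K.Term 0) : φ 0 y = φ₀ y := LinearMap.congr_fun h0 y
  let D : ConeData X K u.degree := ⟨φ, hφ, hφd, by
    intro y hy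
    rw [h0', hφ₀, hX.mem_range, ← hcolon, ← hK.mem_range, hK.single_base] at hy
    exact hy⟩
  have hD (y : K.Term 0) : D.φ 0 y = Finsupp.single b (p * y c) := h0' y
  refine ⟨D, hX.eq_base, hX.deg_base, fun f => ?_⟩
  rw [Submodule.mem_sup]
  constructor
  · rintro ⟨z, hz⟩
    change X.B 1 ⊕ K.B 0 →₀ MvPolynomial (Fin n) k at z
    obtain ⟨⟨x, y⟩, rfl⟩ := (splitSum k n (X.B 1) (K.B 0)).symm.surjective z
    have hz' : X.d 0 x + D.φ 0 y = Finsupp.single b f := (D.dZero_symm_apply x y).symm.trans hz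
    refine ⟨X.d 0 x b, hX.apply_mem x, p * y c,
      Ideal.mul_mem_right _ _ (Ideal.subset_span rfl), ?_⟩
    have := DFunLike.congr_fun hz' b
    rwa [hD, Finsupp.add_apply, Finsupp.single_eq_same, Finsupp.single_eq_same] at this
  · rintro ⟨g, hg, _, hq, rfl⟩
    obtain ⟨q, rfl⟩ := Ideal.mem_span_singleton.mp hq
    obtain ⟨x, hx⟩ := (hX.mem_range g).mpr hg
    refine ⟨(splitSum k n (X.B 1) (K.B 0)).symm (x, Finsupp.single c q), ?_⟩
    refine (D.dZero_symm_apply x _).trans ?_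
    rw [hD, hx, Finsupp.single_eq_same]
    exact (Finsupp.single_add _ _ _).symm

variable (k n) in
/-- The resolution of `S/0`. -/
noncomputable def trivial : FreeComplex k n where
  B
    | 0 => PUnit
    | _ + 1 => PEmpty
  deg _ _ := 0
  d _ := 0
  homog _ := IsHomog.zero
  exact i x := by
    have : x = 0 := Finsupp.ext fun b => nomatch b
    simp [this]

theorem trivial_resolves : (trivial k n).Resolves ⊥ PUnit.unit where
  eq_base _ := rfl
  deg_base := rfl
  mem_range f := by
    rw [Ideal.mem_bot]
    constructor
    · rintro ⟨x, hx⟩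
      exact Finsupp.single_eq_zero.mp (hx.symm.trans rfl)
    · rintro rfl
      exact ⟨0, (Finsupp.single_zero _).symm⟩

/-- The Koszul resolution of the quotient by an ideal generated by variables. -/
theorem exists_koszul (C : Finset (Fin n)) :
    ∃ (K : FreeComplex k n) (b : K.B 0), K.Resolves (Ideal.span (MvPolynomial.X '' (C : Set _))) b ∧
      (∀ i b, K.deg i b = i) ∧ (∀ i, Finite (K.B i)) ∧ ∀ i, Nat.card (K.B i) = C.card.choose i := by
  classical
  induction C using Finset.induction_on with
  | empty =>
    refine ⟨trivial k n, PUnit.unit, ?_, ?_, ?_, ?_⟩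
    · rw [Finset.coe_empty, Set.image_empty, Ideal.span_empty]
      exact trivial_resolves
    · rintro (_ | i) b
      · rfl
      · exact nomatch b
    · rintro (_ | i)
      · exact inferInstanceAs (Finite PUnit)
      · exact inferInstanceAs (Finite PEmpty)
    · rintro (_ | i)
      · exact (Nat.card_unique (α := PUnit)).trans rfl
      · exact (Nat.card_of_isEmpty (α := PEmpty)).trans rfl
  | insert a C ha ih =>
    obtain ⟨K, b, hK, hdeg, hfin, hcard⟩ := ih
    have hX : MvPolynomial.monomial (Finsupp.single a 1) (1 : k) = MvPolynomial.X a := rfl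
    -- Since `a ∉ C`, the colon of the ideal `(C)` by `x_a` is `(C)` itself, so the cone is taken on
    -- `K` and its own shift; the ranks follow from Pascal's rule.
    obtain ⟨D, hD⟩ := hK.exists_coneData hK (Finsupp.single a 1) (by
      intro f
      simp only [MvPolynomial.mem_ideal_span_X_image, MvPolynomial.mem_support_iff]
      constructor
      · intro h m hm
        rw [MvPolynomial.coeff_monomial_mul'] at hm
        split_ifs at hm with hle
        · obtain ⟨j, hj, hne⟩ := h (m - Finsupp.single a 1) (by rwa [one_mul] at hm)
          refine ⟨j, hj, fun h0 => hne ?_⟩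
          rw [Finsupp.tsub_apply, h0, Nat.zero_sub]
        · exact absurd rfl hm
      · intro h m hm
        obtain ⟨j, hj, hne⟩ := h (Finsupp.single a 1 + m)
          (by rwa [MvPolynomial.coeff_monomial_mul, one_mul])
        refine ⟨j, hj, ?_⟩
        rwa [Finsupp.add_apply, Finsupp.single_eq_of_ne, zero_add] at hne
        rintro rfl
        exact ha hj)
    refine ⟨D.cone, b, ?_, ?_, ?_, ?_⟩
    · rwa [Finset.coe_insert, Set.image_insert_eq, Ideal.span_insert, sup_comm, ← hX]
    · rintro (_ | i) c
      · exact hdeg 0 c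
      · obtain c | c := c
        · exact hdeg (i + 1) c
        · change K.deg i c + ((Finsupp.single a 1).degree : ℕ) = ((i + 1 : ℕ) : ℤ)
          rw [hdeg, Finsupp.degree_single]
          push_cast
          rfl
    · rintro (_ | i)
      · exact hfin 0
      · have := hfin i
        have := hfin (i + 1)
        exact inferInstanceAs (Finite (K.B (i + 1) ⊕ K.B i))
    · rintro (_ | i)
      · exact (hcard 0).trans (by simp)
      · have := hfin i
        have := hfin (i + 1)
        refine (Nat.card_sum (α := K.B (i + 1)) (β := K.B i)).trans ?_
        rw [hcard, hcard, Finset.card_insert_of_notMem ha, Nat.choose_succ_succ, add_comm]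

end FreeComplex

/-! ### Ideals with linear quotients -/

/-- The ideal generated by the monomials `x^v`, `v ∈ s`, has a minimal graded free resolution with
`binom(|C(v)|, i)` basis vectors of degree `deg v + i` in homological degree `i`, for `v ∈ s`. -/
def HasLinearQuotientResolution (k : Type u) [Field k] {n : ℕ} (s : Finset (Fin n →₀ ℕ))
    (C : (Fin n →₀ ℕ) → Finset (Fin n)) : Prop :=
  ∃ (X : FreeComplex k n) (b : X.B 0),
    X.Resolves (Ideal.span ((fun a => MvPolynomial.monomial a (1 : k)) '' (s : Set _))) b ∧
    (∀ i, Finite (X.B i)) ∧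
    (∀ i b c, (X.d (i + 1) (Finsupp.single b 1) c).coeff 0 = 0) ∧
    (∀ i b, ∃ v ∈ s, X.deg (i + 1) b = v.degree + i) ∧
    ∀ (i : ℕ) (e : ℤ), Nat.card {b : X.B (i + 1) // X.deg (i + 1) b = e} =
      ∑ v ∈ s, if (v.degree : ℤ) + i = e then (C v).card.choose i else 0

theorem HasLinearQuotientResolution.empty (C : (Fin n →₀ ℕ) → Finset (Fin n)) :
    HasLinearQuotientResolution k ∅ C := by
  refine ⟨FreeComplex.trivial k n, PUnit.unit, ?_, ?_, ?_, ?_, fun i e => ?_⟩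
  · rw [Finset.coe_empty, Set.image_empty, Ideal.span_empty]
    exact FreeComplex.trivial_resolves
  · rintro (_ | i)
    · exact inferInstanceAs (Finite PUnit)
    · exact inferInstanceAs (Finite PEmpty)
  · exact fun i b => PEmpty.elim b
  · exact fun i b => PEmpty.elim b
  · have : IsEmpty {b : (FreeComplex.trivial k n).B (i + 1) //
        (FreeComplex.trivial k n).deg (i + 1) b = e} := ⟨fun b => nomatch b.1⟩
    rw [Nat.card_of_isEmpty, Finset.sum_empty]

/-- The cone of the shifted Koszul complex on `C(u)` stays minimal for degree reasons: the
comparison map sends basis vectors of degree `deg u + i + 1` to ones of degree `deg v + i` with `deg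
v ≤ deg u`, so its entries have no constant term. -/
theorem HasLinearQuotientResolution.insert [DecidableEq (Fin n →₀ ℕ)] {s : Finset (Fin n →₀ ℕ)}
    {C : (Fin n →₀ ℕ) → Finset (Fin n)} (hs : HasLinearQuotientResolution k s C)
    {u : Fin n →₀ ℕ} (hu : u ∉ s) (hdeg : ∀ v ∈ s, v.degree ≤ u.degree)
    (hcolon : ∀ f, f ∈ Ideal.span (MvPolynomial.X '' (C u : Set (Fin n))) ↔
      MvPolynomial.monomial u (1 : k) * f ∈
        Ideal.span ((fun a => MvPolynomial.monomial a (1 : k)) '' (s : Set (Fin n →₀ ℕ)))) :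
    HasLinearQuotientResolution k (insert u s) C := by
  obtain ⟨X, b, hX, hfin, hmin, hdX, hcard⟩ := hs
  obtain ⟨K, c, hK, hdK, hfinK, hcardK⟩ := FreeComplex.exists_koszul (k := k) (C u)
  obtain ⟨D, hD⟩ := hX.exists_coneData hK u hcolon
  refine ⟨D.cone, b, ?_, ?_, ?_, ?_, ?_⟩
  · rwa [Finset.coe_insert, Set.image_insert_eq, Ideal.span_insert, sup_comm]
  · rintro (_ | i)
    · exact hfin 0
    · have := hfin (i + 1)
      have := hfinK i
      exact inferInstanceAs (Finite (X.B (i + 1) ⊕ K.B i))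
  · refine fun i => D.coeff_dSucc i (hmin i) (fun a a' => ?_) fun a a' => ?_
    · refine coeff_zero_of_mem_polyPiece ?_ (K.homog i a a')
      rw [hdK, hdK]
      omega
    · refine coeff_zero_of_mem_polyPiece ?_ (D.homog (i + 1) a a')
      obtain ⟨v, hv, hva⟩ := hdX i a'
      have := hdeg v hv
      beta_reduce
      rw [hva, hdK]
      omega
  · rintro i (a | a)
    · obtain ⟨v, hv, hva⟩ := hdX i a
      exact ⟨v, Finset.mem_insert_of_mem hv, hva⟩
    · refine ⟨u, Finset.mem_insert_self _ _, ?_⟩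
      change K.deg i a + u.degree = _
      rw [hdK, add_comm]
  · intro i e
    have := hfin (i + 1)
    have := hfinK i
    have h1 : Nat.card {b : D.cone.B (i + 1) // D.cone.deg (i + 1) b = e} =
        Nat.card ({b : X.B (i + 1) // X.deg (i + 1) b = e} ⊕
          {b : K.B i // K.deg i b + u.degree = e}) :=
      Nat.card_congr (Equiv.subtypeSum (α := X.B (i + 1)) (β := K.B i))
    rw [h1, Nat.card_sum, hcard, Finset.sum_insert hu, add_comm]
    congr 1
    split_ifs with h
    · rw [← hcardK]
      exact Nat.card_congr (Equiv.subtypeUnivEquiv fun b => by rw [hdK, add_comm]; exact h)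
    · have : IsEmpty {b : K.B i // K.deg i b + u.degree = e} :=
        ⟨fun b => h (by rw [add_comm, ← hdK i b.1]; exact b.2)⟩
      exact Nat.card_of_isEmpty

/-- Graded Betti numbers from a resolution by linear quotients. -/
theorem HasLinearQuotientResolution.hasGradedBetti {s : Finset (Fin n →₀ ℕ)}
    {C : (Fin n →₀ ℕ) → Finset (Fin n)} (hs : HasLinearQuotientResolution k s C)
    {I : Ideal (MvPolynomial (Fin n) k)}
    (hI : I = Ideal.span ((fun a => MvPolynomial.monomial a (1 : k)) '' (s : Set _)))
    (i : ℕ) (j : ℤ) :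
    HasGradedBetti I i (i + j) (∑ v ∈ s with (v.degree : ℤ) = j, (C v).card.choose i) := by
  obtain ⟨X, b, hX, hfin, hmin, -, hcard⟩ := hs
  rw [← hI] at hX
  -- A resolution of `S/I` becomes one of `I` by removing the term `S` in position 0, with `X.d 0`
  -- as augmentation.
  let G : GradedFreeResolution (polyPiece k n) I :=
    { B := fun i => X.B (i + 1)
      deg := fun i => X.deg (i + 1)
      d := fun i => X.d (i + 1)
      aug := (Finsupp.lapply b ∘ₗ X.d 0).codRestrict I hX.apply_mem
      d_homogeneous := fun i => X.homog (i + 1)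
      aug_homogeneous := fun a => by
        have := X.homog 0 a b
        rwa [hX.deg_base, sub_zero] at this
      aug_surjective := by
        rintro ⟨f, hf⟩
        obtain ⟨x, hx⟩ := (hX.mem_range f).mpr hf
        refine ⟨x, Subtype.ext ?_⟩
        change X.d 0 x b = f
        rw [hx, Finsupp.single_eq_same]
      exact_zero := fun x => by
        refine Iff.trans ?_ (X.exact 0 x)
        rw [← hX.single_base (X.d 0 x), Finsupp.single_eq_zero]
        exact Subtype.ext_iff
      exact_succ := fun i => X.exact (i + 1) }
  refine ⟨⟨G⟩, fun F => ?_⟩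
  rw [le_antisymm (GradedFreeResolution.rank_Tor_le _ F G i _)
    (GradedFreeResolution.rank_Tor_le _ G F i _), GradedFreeResolution.rank_Tor_of_minimal G hmin]
  change Cardinal.mk {b : X.B (i + 1) // X.deg (i + 1) b = i + j} = _
  have := hfin (i + 1)
  rw [← Nat.cast_card, hcard, Finset.sum_filter]
  congr 1
  refine Finset.sum_congr rfl fun v _ => ?_
  simp only [add_comm (v.degree : ℤ), add_right_inj]

/-! ### Symmetric shifted ideals have linear quotients -/

theorem monomial_mem_of_le {I : Ideal (MvPolynomial (Fin n) k)} {a b : Fin n →₀ ℕ}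
    (ha : MvPolynomial.monomial a (1 : k) ∈ I) (hab : a ≤ b) :
    MvPolynomial.monomial b (1 : k) ∈ I := by
  have := I.mul_mem_left (MvPolynomial.monomial (b - a) (1 : k)) ha
  rwa [MvPolynomial.monomial_mul, tsub_add_cancel_of_le hab, mul_one] at this

theorem mem_minGens {I : Ideal (MvPolynomial (Fin n) k)} {a : Fin n →₀ ℕ} :
    a ∈ minGens I ↔ Minimal (fun b => MvPolynomial.monomial b (1 : k) ∈ I) a :=
  Set.Finite.mem_toFinset _

theorem exists_minGens_le {I : Ideal (MvPolynomial (Fin n) k)} {a : Fin n →₀ ℕ}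
    (ha : MvPolynomial.monomial a (1 : k) ∈ I) : ∃ v ∈ minGens I, v ≤ a := by
  obtain ⟨v, hva, hv⟩ := exists_minimal_le_of_wellFoundedLT
    (fun b => MvPolynomial.monomial b (1 : k) ∈ I) a ha
  exact ⟨v, mem_minGens.mpr hv, hva⟩

theorem IsMonomialIdeal.eq_span_minGens {I : Ideal (MvPolynomial (Fin n) k)}
    (hI : IsMonomialIdeal I) :
    I = Ideal.span ((fun a => MvPolynomial.monomial a (1 : k)) '' (minGens I : Set _)) := by
  obtain ⟨A, hA⟩ := hI
  refine le_antisymm ?_ (Ideal.span_le.mpr ?_)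
  · conv_lhs => rw [hA]
    refine Ideal.span_le.mpr ?_
    rintro _ ⟨a, ha, rfl⟩
    obtain ⟨v, hv, hva⟩ := exists_minGens_le (I := I) (a := a)
      (by rw [hA]; exact Ideal.subset_span ⟨a, ha, rfl⟩)
    exact monomial_mem_of_le (Ideal.subset_span ⟨v, hv, rfl⟩) hva
  · rintro _ ⟨v, hv, rfl⟩
    exact (mem_minGens.mp hv).prop

theorem IsSymmFixed.monomial_mapDomain_mem {I : Ideal (MvPolynomial (Fin n) k)}
    (hI : IsSymmFixed I) (σ : Equiv.Perm (Fin n)) {a : Fin n →₀ ℕ}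
    (ha : MvPolynomial.monomial a (1 : k) ∈ I) :
    MvPolynomial.monomial (a.mapDomain σ) (1 : k) ∈ I := by
  rw [← MvPolynomial.rename_monomial, ← hI σ]
  exact Ideal.mem_map_of_mem _ ha

/-- In a symmetric shifted ideal, one may replace a variable of maximal exponent in a monomial by
any variable of smaller exponent. -/
theorem IsSymmetricShifted.exchange {I : Ideal (MvPolynomial (Fin n) k)}
    (hI : IsSymmetricShifted I) {a : Fin n →₀ ℕ} (ha : MvPolynomial.monomial a (1 : k) ∈ I)
    {i l : Fin n} (hl : ∀ j, a j ≤ a l) (hi : a i < a l) :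
    MvPolynomial.monomial (a - Finsupp.single l 1 + Finsupp.single i 1) (1 : k) ∈ I := by
  classical
  have hn : n - 1 < n := Nat.sub_lt (Nat.zero_lt_of_lt l.2) one_pos
  let m : Fin n := ⟨n - 1, hn⟩
  have hm (j : Fin n) : j ≤ m := Fin.le_def.mpr (Nat.le_sub_one_of_lt j.2)
  have hsort : a (Tuple.sort a m) = a l := by
    refine le_antisymm (hl _) ?_
    have := Tuple.monotone_sort (a : Fin n → ℕ) (hm ((Tuple.sort a).symm l))
    simpa using this
  -- Sorting may put another variable of maximal exponent last; the swap places `l` there and keeps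
  -- the sorted exponents, since the two are equal.
  let σ : Equiv.Perm (Fin n) := (Tuple.sort a).trans (Equiv.swap (Tuple.sort a m) l)
  have hσm : σ m = l := by simp [σ]
  have haσ (j : Fin n) : a (σ j) = a (Tuple.sort a j) := by
    simp only [σ, Equiv.trans_apply, Equiv.swap_apply_def]
    split_ifs with h1 h2
    · rw [h1, hsort]
    · rw [h2, hsort]
    · rfl
  have hlam (j : Fin n) : a.mapDomain σ.symm j = a (σ j) := by
    rw [Finsupp.mapDomain_equiv_apply, Equiv.symm_symm]
  have h1 := hI.symm_fixed.monomial_mapDomain_mem σ.symm ha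
  have h2 := hI.shift _ (fun j j' hj => by
    rw [hlam, hlam, haσ, haσ]; exact Tuple.monotone_sort (a : Fin n → ℕ) hj) h1 (σ.symm i) m
    (Nat.sub_add_cancel (Nat.zero_lt_of_lt l.2)) (lt_of_le_of_ne (hm _) (by
      intro h
      rw [Equiv.symm_apply_eq, hσm] at h
      rw [h] at hi
      exact lt_irrefl _ hi))
    (by rw [hlam, hlam, hσm, Equiv.apply_symm_apply]; exact hi)
  have h3 := hI.symm_fixed.monomial_mapDomain_mem σ h2
  convert! h3 using 1
  refine congrArg (fun b => MvPolynomial.monomial b (1 : k)) ?_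
  ext j
  rw [Finsupp.mapDomain_equiv_apply, Finsupp.add_apply, Finsupp.add_apply, Finsupp.tsub_apply,
    Finsupp.tsub_apply, hlam, Equiv.apply_symm_apply, Finsupp.single_apply, Finsupp.single_apply,
    Finsupp.single_apply, Finsupp.single_apply]
  simp only [Equiv.eq_symm_apply, hσm, Equiv.apply_symm_apply]

/-! ### The order on the minimal generators -/

theorem le_maxExp (a : Fin n →₀ ℕ) (i : Fin n) : a i ≤ maxExp a :=
  Finset.le_sup (f := a) (Finset.mem_univ i)

theorem exists_eq_maxExp (a : Fin n →₀ ℕ) (i : Fin n) : ∃ l, a l = maxExp a := by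
  obtain ⟨l, -, hl⟩ := Finset.exists_mem_eq_sup Finset.univ ⟨i, Finset.mem_univ i⟩ a
  exact ⟨l, hl.symm⟩

/-- The largest index of a variable of maximal exponent. -/
def topIndex (a : Fin n →₀ ℕ) : ℕ :=
  (Finset.univ.filter fun l => a l = maxExp a).sup fun l => (l : ℕ)

theorem le_topIndex {a : Fin n →₀ ℕ} {l : Fin n} (hl : a l = maxExp a) : (l : ℕ) ≤ topIndex a :=
  Finset.le_sup (f := fun l : Fin n => (l : ℕ)) (Finset.mem_filter.mpr ⟨Finset.mem_univ l, hl⟩)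

theorem exists_eq_topIndex (a : Fin n →₀ ℕ) (i : Fin n) :
    ∃ l : Fin n, a l = maxExp a ∧ (l : ℕ) = topIndex a := by
  obtain ⟨l₀, hl₀⟩ := exists_eq_maxExp a i
  obtain ⟨l, hl, h⟩ := Finset.exists_mem_eq_sup (Finset.univ.filter fun l => a l = maxExp a)
    ⟨l₀, Finset.mem_filter.mpr ⟨Finset.mem_univ _, hl₀⟩⟩ fun l => (l : ℕ)
  exact ⟨l, (Finset.mem_filter.mp hl).2, h.symm⟩

theorem mem_varsC {a : Fin n →₀ ℕ} {i : Fin n} :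
    i ∈ varsC a ↔ a i + 1 < maxExp a ∨ a i + 1 = maxExp a ∧ ∃ l, a l = maxExp a ∧ i < l := by
  simp [varsC]

/-- The key by which the minimal generators are ordered. -/
noncomputable def orderKey (a : Fin n →₀ ℕ) : ℕ ×ₗ ℕ ×ₗ ℕ := toLex (a.degree, toLex (maxExp a, topIndex a))

theorem orderKey_lt {a b : Fin n →₀ ℕ} : orderKey a < orderKey b ↔ a.degree < b.degree ∨
    a.degree = b.degree ∧ (maxExp a < maxExp b ∨ maxExp a = maxExp b ∧ topIndex a < topIndex b) := by
  simp [orderKey, Prod.Lex.toLex_lt_toLex]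

theorem degree_le_of_orderKey_le {a b : Fin n →₀ ℕ} (h : orderKey a ≤ orderKey b) :
    a.degree ≤ b.degree := by
  by_contra! hlt
  exact absurd h (not_le.mpr (orderKey_lt.mpr (Or.inl hlt)))

theorem degree_exchange {a : Fin n →₀ ℕ} {i l : Fin n} (h : a l ≠ 0) :
    (a - Finsupp.single l 1 + Finsupp.single i 1).degree = a.degree := by
  have h1 : a - Finsupp.single l 1 + Finsupp.single l 1 = a :=
    tsub_add_cancel_of_le (Finsupp.single_le_iff.mpr (Nat.one_le_iff_ne_zero.mpr h))
  have h2 := congrArg Finsupp.degree h1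
  rw [map_add, Finsupp.degree_single] at h2
  rw [map_add, Finsupp.degree_single, h2]

theorem exchange_apply (a : Fin n →₀ ℕ) (i l j : Fin n) :
    (a - Finsupp.single l 1 + Finsupp.single i 1 : Fin n →₀ ℕ) j =
      a j - (if l = j then 1 else 0) + (if i = j then 1 else 0) := by
  rw [Finsupp.add_apply, Finsupp.tsub_apply, Finsupp.single_apply, Finsupp.single_apply]

theorem degree_lt_of_le_of_ne {a b : Fin n →₀ ℕ} (h : a ≤ b) (hne : a ≠ b) :
    a.degree < b.degree := by
  have h1 : b - a + a = b := tsub_add_cancel_of_le h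
  have h2 := congrArg Finsupp.degree h1
  rw [map_add] at h2
  have h3 : (b - a).degree ≠ 0 := by
    rw [Ne, Finsupp.degree_eq_zero_iff]
    intro h0
    rw [h0, zero_add] at h1
    exact hne h1
  omega

/-- No exponent rises above the old maximum. If the maximum survives, the variables attaining it are
old ones other than the last, `l`, or `i` itself; in the latter case `u i` was one below the
maximum, and the definition of `varsC` forces `i < l`. So `topIndex` drops. -/
theorem orderKey_exchange_lt {u : Fin n →₀ ℕ} {i l : Fin n} (hi : i ∈ varsC u)
    (hl : u l = maxExp u) (hl' : (l : ℕ) = topIndex u) :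
    orderKey (u - Finsupp.single l 1 + Finsupp.single i 1) < orderKey u := by
  rw [mem_varsC] at hi
  have hlt : u i < u l := by omega
  have hil : l ≠ i := by rintro rfl; exact lt_irrefl _ hlt
  set w := u - Finsupp.single l 1 + Finsupp.single i 1 with hw
  have hwi : w i = u i + 1 := by rw [hw, exchange_apply, if_neg hil, if_pos rfl, tsub_zero]
  have hwl : w l = u l - 1 := by rw [hw, exchange_apply, if_pos rfl, if_neg hil.symm, add_zero]
  have hwj (j : Fin n) (h1 : l ≠ j) (h2 : i ≠ j) : w j = u j := by
    rw [hw, exchange_apply, if_neg h1, if_neg h2, tsub_zero, add_zero]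
  have hle : maxExp w ≤ maxExp u := by
    refine Finset.sup_le fun j _ => ?_
    by_cases h1 : l = j
    · rw [← h1, hwl]; omega
    by_cases h2 : i = j
    · rw [← h2, hwi]; omega
    rw [hwj j h1 h2]
    exact le_maxExp u j
  refine orderKey_lt.mpr (Or.inr ⟨degree_exchange (by omega), ?_⟩)
  rcases hle.lt_or_eq with h | h
  · exact Or.inl h
  refine Or.inr ⟨h, ?_⟩
  obtain ⟨j, hj, hjt⟩ := exists_eq_topIndex w i
  rw [← hjt, ← hl']
  have h1 : l ≠ j := by rintro rfl; omega
  by_cases h2 : i = j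
  · rw [← h2] at hj ⊢
    rcases hi with hi | ⟨-, l', hl'1, hl'2⟩
    · omega
    · have := le_topIndex hl'1
      have := Fin.lt_def.mp hl'2
      omega
  · rw [hwj j h1 h2, h] at hj
    have := le_topIndex hj
    have := Fin.val_ne_of_ne h1
    omega

/-! ### The colon ideals -/

/-- Exchanging the last maximal variable of `u` for `x_i` gives a monomial of `I` with smaller key
that divides `x^u x_i`. A generator dividing it is either that monomial or of smaller degree. -/
theorem IsSymmetricShifted.exists_smaller_generator {I : Ideal (MvPolynomial (Fin n) k)}
    (hI : IsSymmetricShifted I) {u : Fin n →₀ ℕ} (hu : u ∈ minGens I) {i : Fin n}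
    (hi : i ∈ varsC u) :
    ∃ v ∈ minGens I, orderKey v < orderKey u ∧ v ≤ u + Finsupp.single i 1 := by
  obtain ⟨l, hl, hl'⟩ := exists_eq_topIndex u i
  have hlt : u i < u l := by
    have := mem_varsC.mp hi
    omega
  have hw := hI.exchange (mem_minGens.mp hu).prop (fun j => hl ▸ le_maxExp u j) hlt
  have hkey := orderKey_exchange_lt hi hl hl'
  obtain ⟨v, hv, hvw⟩ := exists_minGens_le hw
  refine ⟨v, hv, ?_, hvw.trans (add_le_add_left tsub_le_self _)⟩
  by_cases h : v = u - Finsupp.single l 1 + Finsupp.single i 1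
  · rwa [h]
  · have h1 := degree_lt_of_le_of_ne hvw h
    rw [degree_exchange (by omega)] at h1
    exact orderKey_lt.mpr (Or.inl h1)

/-- While `v` does not divide `u`, a unit is moved from a maximal exponent of `v` exceeding that of
`u` to an index where `v` is below `u`. This lowers the total excess of `v` over `u`, bounded by
`N`, and creates no new excess, so `hex` persists. -/
theorem IsSymmetricShifted.exists_le_of_degree_le {I : Ideal (MvPolynomial (Fin n) k)}
    (hI : IsSymmetricShifted I) {u : Fin n →₀ ℕ} (N : ℕ) (v : Fin n →₀ ℕ)
    (hN : ∑ q, (v q - u q) ≤ N) (hv : MvPolynomial.monomial v (1 : k) ∈ I)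
    (hdeg : v.degree ≤ u.degree) (hex : ∀ q, u q < v q → maxExp u ≤ u q + 1) :
    ∃ w ≤ u, w.degree = v.degree ∧ MvPolynomial.monomial w (1 : k) ∈ I := by
  induction N generalizing v with
  | zero =>
    refine ⟨v, fun q => ?_, rfl, hv⟩
    have := Finset.sum_eq_zero_iff.mp (Nat.le_zero.mp hN) q (Finset.mem_univ q)
    omega
  | succ N ih =>
    by_cases hle : v ≤ u
    · exact ⟨v, hle, rfl, hv⟩
    obtain ⟨q, hq⟩ : ∃ q, u q < v q := by
      by_contra! h
      exact hle h
    obtain ⟨j, hj⟩ : ∃ j, v j < u j := by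
      by_contra! h
      refine absurd hdeg (not_le.mpr (degree_lt_of_le_of_ne h ?_))
      rintro rfl
      exact lt_irrefl _ hq
    -- If `v l ≤ u l` at a maximal exponent of `v`, then `maxExp v ≤ maxExp u ≤ u q + 1 ≤ v q`, so
    -- `q` is itself maximal for `v`.
    obtain ⟨p, hp, hmax⟩ : ∃ p, u p < v p ∧ ∀ r, v r ≤ v p := by
      obtain ⟨l, hl⟩ := exists_eq_maxExp v q
      by_cases h : u l < v l
      · exact ⟨l, h, fun r => hl ▸ le_maxExp v r⟩
      · refine ⟨q, hq, fun r => ?_⟩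
        have h1 := le_maxExp v r
        have h2 := le_maxExp u l
        have h3 := hex q hq
        omega
    have hlt : v j < v p := by
      have h1 := le_maxExp u j
      have h2 := hex p hp
      omega
    have hpj : p ≠ j := by rintro rfl; exact lt_irrefl _ hlt
    have hv' := hI.exchange hv hmax hlt
    have hdeg' := degree_exchange (a := v) (i := j) (l := p) (by omega)
    have hcmp (r : Fin n) :
        (v - Finsupp.single p 1 + Finsupp.single j 1 : Fin n →₀ ℕ) r - u r ≤ v r - u r := by
      rw [exchange_apply]
      by_cases h : j = r
      · rw [← h, if_neg hpj, if_pos rfl]; omega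
      · rw [if_neg h]; omega
    obtain ⟨w, hw, hwd, hwI⟩ := ih (v - Finsupp.single p 1 + Finsupp.single j 1) (by
      have : ∑ r, ((v - Finsupp.single p 1 + Finsupp.single j 1 : Fin n →₀ ℕ) r - u r) <
          ∑ r, (v r - u r) := by
        refine Finset.sum_lt_sum (fun r _ => hcmp r) ⟨p, Finset.mem_univ p, ?_⟩
        rw [exchange_apply, if_pos rfl, if_neg hpj.symm]
        omega
      omega) hv' (hdeg'.trans_le hdeg) (fun r hr => hex r (by have := hcmp r; omega))
    exact ⟨w, hw, hwd.trans hdeg', hwI⟩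

/-- Suppose `v` exceeds `u` only outside `C(u)`. If `deg v < deg u`, exchanges produce a proper
divisor of `u` in `I`. If the degrees agree, any `q` with `u q < v q` attains the maximum of `v`,
equal to that of `u`, and lies weakly right of every maximal index of `u`; the order forces `q` to
be the last of these, contradicting `u q < v q`. Ties of keys are harmless. -/
theorem IsSymmetricShifted.exists_mem_varsC {I : Ideal (MvPolynomial (Fin n) k)}
    (hI : IsSymmetricShifted I) {u v : Fin n →₀ ℕ} (hu : u ∈ minGens I) (hv : v ∈ minGens I)
    (hne : v ≠ u) (hkey : orderKey v ≤ orderKey u) : ∃ i ∈ varsC u, u i < v i := by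
  by_contra! hcon
  have hex (q : Fin n) (hq : u q < v q) :
      maxExp u ≤ u q + 1 ∧ (u q + 1 = maxExp u → ∀ l, u l = maxExp u → l ≤ q) := by
    have h := mt (hcon q) (not_le.mpr hq)
    rw [mem_varsC] at h
    push Not at h
    exact h
  have hdeg := degree_le_of_orderKey_le hkey
  have hmin {w : Fin n →₀ ℕ} (hw : MvPolynomial.monomial w (1 : k) ∈ I) (hwu : w ≤ u) : w = u :=
    le_antisymm hwu ((mem_minGens.mp hu).le_of_le hw hwu)
  rcases hdeg.lt_or_eq with hlt | heq
  · obtain ⟨w, hwu, hwd, hw⟩ := hI.exists_le_of_degree_le _ v le_rfl (mem_minGens.mp hv).prop hdeg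
      fun q hq => (hex q hq).1
    rw [hmin hw hwu] at hwd
    omega
  · obtain ⟨q, hq⟩ : ∃ q, u q < v q := by
      by_contra! h
      exact hne (hmin (mem_minGens.mp hv).prop h)
    have hnot : ¬ orderKey u < orderKey v := not_lt.mpr hkey
    rw [orderKey_lt] at hnot
    push Not at hnot
    obtain ⟨hM, htop⟩ := hnot.2 heq.symm
    have h1 := le_maxExp v q
    obtain ⟨h2, h3⟩ := hex q hq
    obtain ⟨l, hl, hlt⟩ := exists_eq_topIndex u q
    have hvq : v q = maxExp v := by omega
    have h4 := le_topIndex hvq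
    have h5 := htop (by omega)
    have h6 := Fin.le_def.mp (h3 (by omega) l hl)
    have h7 : l = q := Fin.ext (by omega)
    rw [h7] at hl
    omega

/-- Both ideals are monomial, so membership is tested on supports; the two inclusions are
`exists_smaller_generator` and `exists_mem_varsC`. Generators with the same key as `u` may or may
not belong to `s`. -/
theorem IsSymmetricShifted.colon {I : Ideal (MvPolynomial (Fin n) k)}
    (hI : IsSymmetricShifted I) {u : Fin n →₀ ℕ} (hu : u ∈ minGens I) {s : Finset (Fin n →₀ ℕ)}
    (hus : u ∉ s) (hs : s ⊆ minGens I) (hle : ∀ v ∈ s, orderKey v ≤ orderKey u)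
    (hlt : ∀ v ∈ minGens I, orderKey v < orderKey u → v ∈ s) (f : MvPolynomial (Fin n) k) :
    f ∈ Ideal.span (MvPolynomial.X '' (varsC u : Set (Fin n))) ↔
      MvPolynomial.monomial u (1 : k) * f ∈
        Ideal.span ((fun a => MvPolynomial.monomial a (1 : k)) '' (s : Set (Fin n →₀ ℕ))) := by
  simp only [MvPolynomial.mem_ideal_span_X_image, MvPolynomial.mem_ideal_span_monomial_image,
    MvPolynomial.mem_support_iff]
  constructor
  · intro h m hm
    rw [MvPolynomial.coeff_monomial_mul'] at hm
    split_ifs at hm with hum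
    · obtain ⟨i, hi, hne⟩ := h (m - u) (by rwa [one_mul] at hm)
      obtain ⟨v, hv, hvu, hvle⟩ := hI.exists_smaller_generator hu hi
      refine ⟨v, hlt v hv hvu, hvle.trans ?_⟩
      calc u + Finsupp.single i 1 ≤ u + (m - u) :=
            add_le_add_right (Finsupp.single_le_iff.mpr (Nat.one_le_iff_ne_zero.mpr hne)) u
        _ = m := add_tsub_cancel_of_le hum
    · exact absurd rfl hm
  · intro h m hm
    obtain ⟨v, hv, hvle⟩ := h (u + m) (by rwa [MvPolynomial.coeff_monomial_mul, one_mul])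
    obtain ⟨i, hi, hiv⟩ := hI.exists_mem_varsC hu (hs hv)
      (by rintro rfl; exact hus hv) (hle v hv)
    refine ⟨i, hi, fun h0 => ?_⟩
    have := hvle i
    rw [Finsupp.add_apply, h0] at this
    omega

theorem IsSymmetricShifted.hasLinearQuotientResolution {I : Ideal (MvPolynomial (Fin n) k)}
    (hI : IsSymmetricShifted I) : HasLinearQuotientResolution k (minGens I) varsC := by
  classical
  -- The induction runs over sets of generators closed under passing to smaller keys, removing an
  -- element of largest key; ties may be broken arbitrarily.
  suffices H : ∀ s : Finset (Fin n →₀ ℕ), s ⊆ minGens I →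
      (∀ v ∈ minGens I, ∀ w ∈ s, orderKey v < orderKey w → v ∈ s) →
      HasLinearQuotientResolution k s varsC from
    H _ subset_rfl fun v hv _ _ _ => hv
  intro s
  induction s using Finset.induction_on_max_value orderKey with
  | empty => exact fun _ _ => .empty _
  | insert u s hus hle ih =>
    intro hs hlow
    rw [Finset.insert_subset_iff] at hs
    refine (ih hs.2 fun v hv w hw hvw => ?_).insert hus
      (fun v hv => degree_le_of_orderKey_le (hle v hv)) (hI.colon hs.1 hus hs.2 hle ?_)
    · refine (Finset.mem_insert.mp (hlow v hv w (Finset.mem_insert_of_mem hw) hvw)).resolve_left ?_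
      rintro rfl
      exact absurd (hle w hw) (not_le.mpr hvw)
    · intro v hv hvu
      refine (Finset.mem_insert.mp (hlow v hv u (Finset.mem_insert_self _ _) hvu)).resolve_left ?_
      rintro rfl
      exact lt_irrefl _ hvu

end SymmetricShifted

theorem corollary3p3 {k : Type u} [Field k] {n : ℕ} (I : Ideal (MvPolynomial (Fin n) k))
    (hI : SymmetricShifted.IsSymmetricShifted I) (i : ℕ) (j : ℤ) :
    SymmetricShifted.HasGradedBetti I i ((i : ℤ) + j)
      (∑ a ∈ SymmetricShifted.minGens I with (a.degree : ℤ) = j,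
        (SymmetricShifted.varsC a).card.choose i) :=
  hI.hasLinearQuotientResolution.hasGradedBetti hI.monomial.eq_span_minGens i j
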